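/- Let $M$ be a connected smooth Riemannian $m$-manifold without boundary (Hausdorff, second countable), with Riemannian volume measure $\mu$, Levi-Civita connection $\nabla$ and Laplace–Beltrami operator $\Delta=\operatorname{tr}\nabla \mathrm d=-\mathrm d^{\dagger}\mathrm d$. Functions take values in $\mathbb K\in\{\mathbb R,\mathbb C\}$, $|\cdot|$ denotes the pointwise norms induced by the metric (for the Hessian $\nabla \mathrm d\Psi$ the Hilbert–Schmidt norm), and $\|\cdot\|_q$ the norm of $L^q(M,\mu)$. Let $q\in(1,\infty)$, and let $H^{2,q}(M)$ be the Banach space obtained by completing $$\{\Psi\in C^\infty(M)\cap L^q(M) : |\mathrm d\Psi|,\ |\nabla \mathrm d\Psi|\in L^q(M)\}$$ with respect to the norm $\|\Psi\|_{2,q}=\|\Psi\|_q+\|\mathrm d\Psi\|_q+\|\nabla \mathrm d\Psi\|_q$. Assume: 1. $M$ admits a sequence of Laplacian cut-off functions, that is, real-valued $\chi_n\in C_c^\infty(M)$, $n\in\mathbb N$, such that $0\le\chi_n\le 1$ for all $n$; for every compact $K\subset M$ there is $n_0$ with $\chi_n|_K=1$ for all $n\ge n_0$; $\sup_{x\in M}|\mathrm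 d\chi_n(x)|\to 0$; and $\sup_{x\in M}|\Delta\chi_n(x)|\to 0$ as $n\to\infty$. 2. $M$ satisfies the $L^q$ Calderón–Zygmund inequality, that is, there are constants $C_q>0$ and $D_q\ge 0$ such that for all $\Psi\in C_c^\infty(M)$ $$\|\nabla \mathrm d\Psi\|_q\le C_q\|\Delta\Psi\|_q+D_q\|\Psi\|_q .$$ Then $C_c^\infty(M)$ is dense in $H^{2,q}(M)$. -/

import Mathlib

open Set Filter Topology MeasureTheory Manifold
open scoped ContDiff

set_option linter.unusedSectionVars false

noncomputable section

namespace RiemSobolev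

/-! ## Calculus in a normed space -/

/-- Trace of a bilinear map with respect to an orthonormal basis, computed in any frame. -/
theorem sum_orthonormal {m : ℕ} {V W : Type*} [NormedAddCommGroup V] [InnerProductSpace ℝ V]
    [AddCommGroup W] [Module ℝ W] (e : OrthonormalBasis (Fin m) ℝ V) (c : Fin m → V)
    (hg : IsUnit (Matrix.of fun i j => inner ℝ (c i) (c j)).det) (Q : V →ₗ[ℝ] V →ₗ[ℝ] W) :
    ∑ k, Q (e k) (e k) =
      ∑ i, ∑ j, (Matrix.of fun i j => inner ℝ (c i) (c j))⁻¹ i j • Q (c i) (c j) := by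
  set g : Matrix (Fin m) (Fin m) ℝ := Matrix.of fun i j => inner ℝ (c i) (c j) with hgdef
  let P : Matrix (Fin m) (Fin m) ℝ := Matrix.of fun k i => inner ℝ (e k) (c i)
  have hc : ∀ i, c i = ∑ k, P k i • e k := fun i => (e.sum_repr' (c i)).symm
  have hgP : g = P.transpose * P := by
    ext i j
    rw [Matrix.mul_apply]
    simp only [hgdef, Matrix.of_apply, Matrix.transpose_apply, P]
    rw [← e.sum_inner_mul_inner (c i) (c j)]
    exact Finset.sum_congr rfl fun k _ => by rw [real_inner_comm]
  have hP : IsUnit P.det := by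
    have := hg
    rw [hgP, Matrix.det_mul] at this
    exact isUnit_of_mul_isUnit_right this
  have hPP : P * g⁻¹ * P.transpose = 1 := by
    rw [hgP, Matrix.mul_inv_rev, ← Matrix.mul_assoc, Matrix.mul_nonsing_inv _ hP, Matrix.one_mul,
      Matrix.nonsing_inv_mul _ (by rwa [Matrix.det_transpose])]
  symm
  calc ∑ i, ∑ j, g⁻¹ i j • Q (c i) (c j)
      = ∑ i, ∑ j, ∑ k, ∑ l, (P k i * g⁻¹ i j * P l j) • Q (e k) (e l) := by
        refine Finset.sum_congr rfl fun i _ => Finset.sum_congr rfl fun j _ => ?_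
        rw [hc i, hc j]
        simp only [map_sum, LinearMap.sum_apply, map_smul, LinearMap.smul_apply, Finset.smul_sum,
          smul_smul]
        rw [Finset.sum_comm]
        exact Finset.sum_congr rfl fun k _ => Finset.sum_congr rfl fun l _ => by congr 1; ring
    _ = ∑ k, ∑ l, (P * g⁻¹ * P.transpose) k l • Q (e k) (e l) := by
        have : ∀ k l, (P * g⁻¹ * P.transpose) k l = ∑ i, ∑ j, P k i * g⁻¹ i j * P l j := by
          intro k l
          simp only [Matrix.mul_apply, Matrix.transpose_apply, Finset.sum_mul]
          rw [Finset.sum_comm]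
        simp only [this, Finset.sum_smul]
        rw [Finset.sum_congr rfl fun i _ => Finset.sum_comm, Finset.sum_comm]
        refine Finset.sum_congr rfl fun k _ => ?_
        rw [Finset.sum_congr rfl fun i _ => Finset.sum_comm, Finset.sum_comm]
    _ = ∑ k, Q (e k) (e k) := by
        rw [hPP]
        simp [Matrix.one_apply]

variable {E : Type*} [NormedAddCommGroup E] [NormedSpace ℝ E] 
  {F : Type*} [NormedAddCommGroup F] [NormedSpace ℝ F]

/-- Second derivative of a composition. -/
theorem fderiv_fderiv_comp {f f' : E → F} {ψ : E → E} {y : E} (hf : ContDiffAt ℝ 2 f (ψ y))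
    (hψ : ContDiffAt ℝ 2 ψ y) (h : f' =ᶠ[𝓝 y] f ∘ ψ) (u v : E) :
    fderiv ℝ (fderiv ℝ f') y u v =
      fderiv ℝ (fderiv ℝ f) (ψ y) (fderiv ℝ ψ y u) (fderiv ℝ ψ y v)
        + fderiv ℝ f (ψ y) (fderiv ℝ (fderiv ℝ ψ) y u v) := by
  have hψ' : DifferentiableAt ℝ (fderiv ℝ ψ) y :=
    (hψ.fderiv_right (m := 1) (by norm_num)).differentiableAt (by norm_num)
  have hf' : DifferentiableAt ℝ (fderiv ℝ f) (ψ y) :=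
    (hf.fderiv_right (m := 1) (by norm_num)).differentiableAt (by norm_num)
  have h1 : fderiv ℝ f' =ᶠ[𝓝 y] fun z => (fderiv ℝ f (ψ z)).comp (fderiv ℝ ψ z) := by
    have e1 : ∀ᶠ z in 𝓝 y, DifferentiableAt ℝ ψ z := by
      filter_upwards [hψ.eventually (by simp)] with z hz using hz.differentiableAt (by norm_num)
    have e2 : ∀ᶠ z in 𝓝 y, DifferentiableAt ℝ f (ψ z) := by
      filter_upwards [hψ.continuousAt.eventually (hf.eventually (by simp))] with z hz
        using hz.differentiableAt (by norm_num)
    filter_upwards [h.fderiv (𝕜 := ℝ), e1, e2] with z hz hz1 hz2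
    rw [hz, fderiv_comp z hz2 hz1]
  rw [h1.fderiv_eq]
  have hd : HasFDerivAt (fun z => fderiv ℝ f (ψ z)) ((fderiv ℝ (fderiv ℝ f) (ψ y)).comp (fderiv ℝ ψ y)) y :=
    hf'.hasFDerivAt.comp y (hψ.differentiableAt (by norm_num)).hasFDerivAt
  rw [(hd.clm_comp hψ'.hasFDerivAt).fderiv]
  simp [add_comm]

/-- Derivative of a pulled back field of bilinear forms. -/
theorem fderiv_pullback {G G' : E → E →L[ℝ] E →L[ℝ] ℝ} {ψ : E → E} {y : E}
    (hG : DifferentiableAt ℝ G (ψ y)) (hψ : ContDiffAt ℝ 2 ψ y)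
    (h : G' =ᶠ[𝓝 y] fun z => (G (ψ z)).bilinearComp (fderiv ℝ ψ z) (fderiv ℝ ψ z))
    (hG' : DifferentiableAt ℝ G' y) (u v w : E) :
    fderiv ℝ G' y u v w = fderiv ℝ G (ψ y) (fderiv ℝ ψ y u) (fderiv ℝ ψ y v) (fderiv ℝ ψ y w)
      + G (ψ y) (fderiv ℝ (fderiv ℝ ψ) y u v) (fderiv ℝ ψ y w)
      + G (ψ y) (fderiv ℝ ψ y v) (fderiv ℝ (fderiv ℝ ψ) y u w) := by
  have hψ' : DifferentiableAt ℝ (fderiv ℝ ψ) y :=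
    (hψ.fderiv_right (m := 1) (by norm_num)).differentiableAt (by norm_num)
  have hd : HasFDerivAt (fun z => G (ψ z)) ((fderiv ℝ G (ψ y)).comp (fderiv ℝ ψ y)) y :=
    HasFDerivAt.comp (g := G) (g' := fderiv ℝ G (ψ y)) y hG.hasFDerivAt
      (hψ.differentiableAt (by norm_num)).hasFDerivAt
  have hv : ∀ v, HasFDerivAt (fun z => fderiv ℝ ψ z v) ((fderiv ℝ (fderiv ℝ ψ) y).flip v) y := by
    intro v
    have := hψ'.hasFDerivAt.clm_apply (hasFDerivAt_const v y)
    simpa using this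
  have h2 := (hd.clm_apply (hv v)).clm_apply (hv w)
  have h3 : HasFDerivAt (fun z => G' z v w) ((((fderiv ℝ G' y).flip v).flip w)) y := by
    have := (hG'.hasFDerivAt.clm_apply (hasFDerivAt_const v y)).clm_apply (hasFDerivAt_const w y)
    simpa using this
  have h4 : HasFDerivAt (fun z => G' z v w) _ y :=
    h2.congr_of_eventuallyEq (by filter_upwards [h] with z hz; rw [hz]; rfl)
  have := congrArg (fun L => L u) (h3.unique h4)
  simp at this
  rw [this]; ring

/-- Christoffel symbols of the first kind of a metric `G` given on (an open subset of) `E`: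
for constant vector fields `u`, `v`, `w` on `E` this is `G (∇_u v, w)` at `y`, where `∇` is the
Levi-Civita connection of `G` (Koszul formula; constant fields commute). -/
noncomputable def christoffel (G : E → E →L[ℝ] E →L[ℝ] ℝ) (y u v w : E) : ℝ :=
  (fderiv ℝ G y u v w + fderiv ℝ G y v u w - fderiv ℝ G y w u v) / 2

theorem christoffel_add_left {E : Type*} [NormedAddCommGroup E] [NormedSpace ℝ E]
    (G : E → E →L[ℝ] E →L[ℝ] ℝ) (y u u' v w : E) :
    christoffel G y (u + u') v w = christoffel G y u v w + christoffel G y u' v w := by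
  simp only [christoffel, map_add, add_apply]; ring

theorem christoffel_smul_left {E : Type*} [NormedAddCommGroup E] [NormedSpace ℝ E]
    (G : E → E →L[ℝ] E →L[ℝ] ℝ) (y : E) (c : ℝ) (u v w : E) :
    christoffel G y (c • u) v w = c * christoffel G y u v w := by
  simp only [christoffel, map_smul, smul_apply, smul_eq_mul]; ring

theorem christoffel_add_mid {E : Type*} [NormedAddCommGroup E] [NormedSpace ℝ E]
    (G : E → E →L[ℝ] E →L[ℝ] ℝ) (y u v v' w : E) :
    christoffel G y u (v + v') w = christoffel G y u v w + christoffel G y u v' w := by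
  simp only [christoffel, map_add, add_apply]; ring

theorem christoffel_smul_mid {E : Type*} [NormedAddCommGroup E] [NormedSpace ℝ E]
    (G : E → E →L[ℝ] E →L[ℝ] ℝ) (y : E) (c : ℝ) (u v w : E) :
    christoffel G y u (c • v) w = c * christoffel G y u v w := by
  simp only [christoffel, map_smul, smul_apply, smul_eq_mul]; ring

theorem christoffel_add_right {E : Type*} [NormedAddCommGroup E] [NormedSpace ℝ E]
    (G : E → E →L[ℝ] E →L[ℝ] ℝ) (y u v w w' : E) :
    christoffel G y u v (w + w') = christoffel G y u v w + christoffel G y u v w' := by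
  simp only [christoffel, map_add, add_apply]; ring

theorem christoffel_smul_right {E : Type*} [NormedAddCommGroup E] [NormedSpace ℝ E]
    (G : E → E →L[ℝ] E →L[ℝ] ℝ) (y : E) (c : ℝ) (u v w : E) :
    christoffel G y u v (c • w) = c * christoffel G y u v w := by
  simp only [christoffel, map_smul, smul_apply, smul_eq_mul]; ring

theorem continuousOn_christoffel_of {G : E → E →L[ℝ] E →L[ℝ] ℝ} {s : Set E}
    (hG : ContDiffOn ℝ ∞ G s) (hs : IsOpen s) (u v w : E) :
    ContinuousOn (fun y => christoffel G y u v w) s := by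
  have h := hG.continuousOn_fderiv_of_isOpen hs (by simp)
  have h' : ∀ a b c, ContinuousOn (fun y => fderiv ℝ G y a b c) s := fun a b c =>
    ((h.clm_apply continuousOn_const).clm_apply continuousOn_const).clm_apply continuousOn_const
  exact (((h' _ _ _).add (h' _ _ _)).sub (h' _ _ _)).div_const 2

/-- The Hessian `(∇ df)(u, v) = D²f (u, v) - df (∇_u v)` of `f` at `y` for the Levi-Civita connection
of the metric `G`. Here `e` is meant to be a `G y`-orthonormal basis, so that
`∇_u v = ∑ k, G (∇_u v, e k) • e k`. -/
noncomputable def coordHessian {m : ℕ} (G : E → E →L[ℝ] E →L[ℝ] ℝ) (f : E → F) (y : E)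
    (e : Fin m → E) (u v : E) : F :=
  fderiv ℝ (fderiv ℝ f) y u v - ∑ k, christoffel G y u v (e k) • fderiv ℝ f y (e k)

theorem coordHessian_add_left {m : ℕ} (G : E → E →L[ℝ] E →L[ℝ] ℝ) (f : E → F) (y : E)
    (e : Fin m → E) (u u' v : E) : coordHessian G f y e (u + u') v =
      coordHessian G f y e u v + coordHessian G f y e u' v := by
  simp only [coordHessian, map_add, add_apply, christoffel_add_left, add_smul, Finset.sum_add_distrib]
  abel

theorem coordHessian_smul_left {m : ℕ} (G : E → E →L[ℝ] E →L[ℝ] ℝ) (f : E → F) (y : E)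
    (e : Fin m → E) (c : ℝ) (u v : E) : coordHessian G f y e (c • u) v =
      c • coordHessian G f y e u v := by
  simp only [coordHessian, map_smul, smul_apply, christoffel_smul_left, mul_smul,
    Finset.smul_sum, smul_sub]

theorem coordHessian_add_right {m : ℕ} (G : E → E →L[ℝ] E →L[ℝ] ℝ) (f : E → F) (y : E)
    (e : Fin m → E) (u v v' : E) : coordHessian G f y e u (v + v') =
      coordHessian G f y e u v + coordHessian G f y e u v' := by
  simp only [coordHessian, map_add, christoffel_add_mid, add_smul, Finset.sum_add_distrib]
  abel

theorem coordHessian_smul_right {m : ℕ} (G : E → E →L[ℝ] E →L[ℝ] ℝ) (f : E → F) (y : E)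
    (e : Fin m → E) (c : ℝ) (u v : E) : coordHessian G f y e u (c • v) =
      c • coordHessian G f y e u v := by
  simp only [coordHessian, map_smul, christoffel_smul_mid, mul_smul, Finset.smul_sum, smul_sub]

theorem differentiableAt_fderiv {f : E → F} {y : E} (hf : ContDiffAt ℝ 2 f y) :
    DifferentiableAt ℝ (fderiv ℝ f) y :=
  (hf.fderiv_right (m := 1) (by norm_num)).differentiableAt (by norm_num)

theorem eventually_differentiableAt {f : E → F} {y : E} (hf : ContDiffAt ℝ 2 f y) :
    ∀ᶠ z in 𝓝 y, DifferentiableAt ℝ f z := by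
  filter_upwards [hf.eventually (by simp)] with z hz using hz.differentiableAt (by norm_num)

theorem coordHessian_add {m : ℕ} (G : E → E →L[ℝ] E →L[ℝ] ℝ) {f g : E → F} {y : E}
    (hf : ContDiffAt ℝ 2 f y) (hg : ContDiffAt ℝ 2 g y) (e : Fin m → E) (u v : E) :
    coordHessian G (f + g) y e u v = coordHessian G f y e u v + coordHessian G g y e u v := by
  have h1 : fderiv ℝ (f + g) =ᶠ[𝓝 y] fderiv ℝ f + fderiv ℝ g := by
    filter_upwards [eventually_differentiableAt hf, eventually_differentiableAt hg] with z h h'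
    rw [fderiv_add h h', Pi.add_apply]
  rw [coordHessian, h1.fderiv_eq, h1.self_of_nhds,
    fderiv_add (differentiableAt_fderiv hf) (differentiableAt_fderiv hg)]
  simp only [coordHessian, Pi.add_apply, add_apply, smul_add, Finset.sum_add_distrib]
  abel

theorem coordHessian_const_smul {m : ℕ} {𝕜 : Type*} [RCLike 𝕜] (G : E → E →L[ℝ] E →L[ℝ] ℝ)
    {f : E → 𝕜} {y : E} (hf : ContDiffAt ℝ 2 f y) (c : 𝕜) (e : Fin m → E) (u v : E) :
    coordHessian G (c • f) y e u v = c • coordHessian G f y e u v := by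
  have h1 : fderiv ℝ (c • f) =ᶠ[𝓝 y] c • fderiv ℝ f := by
    filter_upwards [eventually_differentiableAt hf] with z h
    rw [fderiv_const_smul h, Pi.smul_apply]
  rw [coordHessian, h1.fderiv_eq, h1.self_of_nhds,
    fderiv_const_smul (differentiableAt_fderiv hf)]
  simp only [coordHessian, Pi.smul_apply, smul_apply, smul_sub, Finset.smul_sum]
  congr 1
  exact Finset.sum_congr rfl fun k _ => smul_comm _ _ _

theorem coordHessian_eq_zero {m : ℕ} (G : E → E →L[ℝ] E →L[ℝ] ℝ) {f : E → F} {y : E}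
    (hf : f =ᶠ[𝓝 y] 0) (e : Fin m → E) (u v : E) : coordHessian G f y e u v = 0 := by
  have h1 : fderiv ℝ f =ᶠ[𝓝 y] 0 := by
    filter_upwards [hf.fderiv (𝕜 := ℝ)] with z hz
    rw [hz]; simp
  rw [coordHessian, h1.fderiv_eq, h1.self_of_nhds]
  simp

/-- Invariance of the Hessian under a change of coordinates `ψ`. -/
theorem hessian_coord_change {m : ℕ} {f f' : E → F} {G G' : E → E →L[ℝ] E →L[ℝ] ℝ} {ψ : E → E}
    {y : E} (hf : ContDiffAt ℝ 2 f (ψ y)) (hψ : ContDiffAt ℝ 2 ψ y) (h : f' =ᶠ[𝓝 y] f ∘ ψ)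
    (hG : DifferentiableAt ℝ G (ψ y))
    (hGG : G' =ᶠ[𝓝 y] fun z => (G (ψ z)).bilinearComp (fderiv ℝ ψ z) (fderiv ℝ ψ z))
    (hG' : DifferentiableAt ℝ G' y) (hsymm : ∀ a b, G (ψ y) a b = G (ψ y) b a)
    (e : Fin m → E)
    (he : ∀ a, ∑ k, G (ψ y) a (fderiv ℝ ψ y (e k)) • fderiv ℝ ψ y (e k) = a) (u v : E) :
    fderiv ℝ (fderiv ℝ f') y u v - ∑ k, christoffel G' y u v (e k) • fderiv ℝ f' y (e k) =
      fderiv ℝ (fderiv ℝ f) (ψ y) (fderiv ℝ ψ y u) (fderiv ℝ ψ y v)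
        - ∑ k, christoffel G (ψ y) (fderiv ℝ ψ y u) (fderiv ℝ ψ y v) (fderiv ℝ ψ y (e k)) •
            fderiv ℝ f (ψ y) (fderiv ℝ ψ y (e k)) := by
  have hs : ∀ a b, fderiv ℝ (fderiv ℝ ψ) y a b = fderiv ℝ (fderiv ℝ ψ) y b a :=
    fun a b => (hψ.isSymmSndFDerivAt (by simp)).eq a b
  have hK : ∀ w, christoffel G' y u v w =
      christoffel G (ψ y) (fderiv ℝ ψ y u) (fderiv ℝ ψ y v) (fderiv ℝ ψ y w)
        + G (ψ y) (fderiv ℝ (fderiv ℝ ψ) y u v) (fderiv ℝ ψ y w) := by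
    intro w
    simp only [christoffel, fderiv_pullback hG hψ hGG hG']
    rw [hs v u, hs w u, hs w v, hsymm (fderiv ℝ ψ y v), hsymm (fderiv ℝ ψ y u)]
    ring
  have hD : ∀ w, fderiv ℝ f' y w = fderiv ℝ f (ψ y) (fderiv ℝ ψ y w) := by
    intro w
    rw [h.fderiv_eq, fderiv_comp y (hf.differentiableAt (by norm_num))
      (hψ.differentiableAt (by norm_num))]
    rfl
  have hQ : fderiv ℝ f (ψ y) (fderiv ℝ (fderiv ℝ ψ) y u v) =
      ∑ k, G (ψ y) (fderiv ℝ (fderiv ℝ ψ) y u v) (fderiv ℝ ψ y (e k)) •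
        fderiv ℝ f (ψ y) (fderiv ℝ ψ y (e k)) := by
    conv_lhs => rw [← he (fderiv ℝ (fderiv ℝ ψ) y u v)]
    simp
  rw [fderiv_fderiv_comp hf hψ h]
  simp only [hK, hD, add_smul, Finset.sum_add_distrib]
  rw [hQ]
  abel

end RiemSobolev

open Bundle

namespace RiemSobolev

/-! ## Charts and tangent spaces -/

section Charts

variable {m : ℕ} {M : Type*} [TopologicalSpace M] [ChartedSpace (EuclideanSpace ℝ (Fin m)) M]

instance instFiniteDimensionalTangent (x : M) : FiniteDimensional ℝ (TangentSpace (𝓡 m) x) :=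
  inferInstanceAs (FiniteDimensional ℝ (EuclideanSpace ℝ (Fin m)))

theorem finrank_tangentSpace (x : M) : Module.finrank ℝ (TangentSpace (𝓡 m) x) = m :=
  (finrank_euclideanSpace_fin (𝕜 := ℝ) (n := m) : _)

theorem continuous_of_chart {g : M → ℝ} {G : M → EuclideanSpace ℝ (Fin m) → ℝ}
    (hG : ∀ x₀, ContinuousOn (G x₀) (extChartAt (𝓡 m) x₀).target)
    (h : ∀ x₀, ∀ p ∈ (extChartAt (𝓡 m) x₀).source, g p = G x₀ (extChartAt (𝓡 m) x₀ p)) :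
    Continuous g := by
  refine continuous_iff_continuousAt.2 fun x₀ => ?_
  have h1 : ContinuousOn (fun p => G x₀ (extChartAt (𝓡 m) x₀ p)) (extChartAt (𝓡 m) x₀).source :=
    (hG x₀).comp (continuousOn_extChartAt x₀) (extChartAt (𝓡 m) x₀).mapsTo
  have h2 := h1.congr (h x₀)
  exact h2.continuousAt ((isOpen_extChartAt_source x₀).mem_nhds (mem_extChartAt_source x₀))

variable [IsManifold (𝓡 m) ∞ M]

/-- Derivative at `p` of the preferred chart at `x₀`. -/
def coordD (x₀ p : M) : TangentSpace (𝓡 m) p →L[ℝ] EuclideanSpace ℝ (Fin m) :=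
  mvfderiv (𝓡 m) (extChartAt (𝓡 m) x₀) p

theorem mfderiv_symm_coordD {x₀ : M} {y : EuclideanSpace ℝ (Fin m)}
    (hy : y ∈ (extChartAt (𝓡 m) x₀).target)
    (u : TangentSpace (𝓡 m) ((extChartAt (𝓡 m) x₀).symm y)) :
    mfderiv 𝓘(ℝ, EuclideanSpace ℝ (Fin m)) (𝓡 m) (extChartAt (𝓡 m) x₀).symm y
      (coordD x₀ ((extChartAt (𝓡 m) x₀).symm y) u) = u := by
  have := mfderivWithin_extChartAt_symm_comp_mfderiv_extChartAt hy
  simp only [ModelWithCorners.range_eq_univ, mfderivWithin_univ] at this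
  exact congrArg (fun L => L u) this

theorem coordD_mfderiv_symm {x₀ : M} {y : EuclideanSpace ℝ (Fin m)}
    (hy : y ∈ (extChartAt (𝓡 m) x₀).target) (u : EuclideanSpace ℝ (Fin m)) :
    coordD x₀ ((extChartAt (𝓡 m) x₀).symm y)
      (mfderiv 𝓘(ℝ, EuclideanSpace ℝ (Fin m)) (𝓡 m) (extChartAt (𝓡 m) x₀).symm y u) = u := by
  have := mfderiv_extChartAt_comp_mfderivWithin_extChartAt_symm hy
  simp only [ModelWithCorners.range_eq_univ, mfderivWithin_univ] at this
  exact congrArg (fun L => L u) this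

theorem coordD_self (p : M) (u : TangentSpace (𝓡 m) p) : coordD p p u = u :=
  congrArg (fun L => L u) (mfderiv_extChartAt_self (I := 𝓡 m) (x := p))

theorem coordD_surjective {x₀ p : M} (hp : p ∈ (extChartAt (𝓡 m) x₀).source)
    (u : EuclideanSpace ℝ (Fin m)) : ∃ a, coordD x₀ p a = u := by
  obtain ⟨y, hy, rfl⟩ : ∃ y ∈ (extChartAt (𝓡 m) x₀).target, (extChartAt (𝓡 m) x₀).symm y = p :=
    ⟨_, (extChartAt (𝓡 m) x₀).map_source hp, (extChartAt (𝓡 m) x₀).left_inv hp⟩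
  exact ⟨_, coordD_mfderiv_symm hy u⟩

end Charts

section Pointwise

variable {m : ℕ} {M : Type*} [TopologicalSpace M] [ChartedSpace (EuclideanSpace ℝ (Fin m)) M]
  [RiemannianBundle (fun x : M => TangentSpace (𝓡 m) x)]

/-- The Riemannian metric read in the preferred chart `φ` at `x₀`: at a point `y` of the chart target
it is the pull-back of the inner product of the tangent space at `φ⁻¹ y` under `D(φ⁻¹)(y)`,
that is `(u, v) ↦ ∑ g_ij u^i v^j`. -/
def chartMetric (x₀ : M) (y : EuclideanSpace ℝ (Fin m)) :
    EuclideanSpace ℝ (Fin m) →L[ℝ] EuclideanSpace ℝ (Fin m) →L[ℝ] ℝ :=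
  (innerSL ℝ (E := TangentSpace (𝓡 m) ((extChartAt (𝓡 m) x₀).symm y))).bilinearComp
    (mfderiv 𝓘(ℝ, EuclideanSpace ℝ (Fin m)) (𝓡 m) (extChartAt (𝓡 m) x₀).symm y)
    (mfderiv 𝓘(ℝ, EuclideanSpace ℝ (Fin m)) (𝓡 m) (extChartAt (𝓡 m) x₀).symm y)

/-- An orthonormal basis, for the Riemannian metric, of the tangent space at `x`. -/
def tangentBasis (m : ℕ) {M : Type*} [TopologicalSpace M]
    [ChartedSpace (EuclideanSpace ℝ (Fin m)) M]
    [RiemannianBundle (fun x : M => TangentSpace (𝓡 m) x)] (x : M) : OrthonormalBasis (Fin m) ℝ (TangentSpace (𝓡 m) x) :=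
  (stdOrthonormalBasis ℝ (TangentSpace (𝓡 m) x)).reindex (finCongr (finrank_tangentSpace x))

variable {𝕜 : Type*} [RCLike 𝕜]

/-- The Hessian `∇df (u, v)` of `f` at `x` (`∇` the Levi-Civita connection), computed in the preferred
chart at `x`; in Mathlib the tangent space at `x` is the model space, identified with the tangent space
of `M` by the derivative of precisely this chart (cf. `coordD_self`). By `hessian_eq_chart` every
chart around `x` gives the same value if `f` is smooth. -/
def hessian (f : M → 𝕜) (x : M) (u v : TangentSpace (𝓡 m) x) : 𝕜 :=
  coordHessian (chartMetric x) (f ∘ (extChartAt (𝓡 m) x).symm) (extChartAt (𝓡 m) x x)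
    (fun k => tangentBasis m x k) u v

theorem hessian_add_left (f : M → 𝕜) (x : M) (u u' v : TangentSpace (𝓡 m) x) :
    hessian f x (u + u') v = hessian f x u v + hessian f x u' v :=
  coordHessian_add_left _ _ _ _ _ _ _

theorem hessian_smul_left (f : M → 𝕜) (x : M) (c : ℝ) (u v : TangentSpace (𝓡 m) x) :
    hessian f x (c • u) v = c • hessian f x u v :=
  coordHessian_smul_left _ _ _ _ _ _ _

theorem hessian_add_right (f : M → 𝕜) (x : M) (u v v' : TangentSpace (𝓡 m) x) :
    hessian f x u (v + v') = hessian f x u v + hessian f x u v' :=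
  coordHessian_add_right _ _ _ _ _ _ _

theorem hessian_smul_right (f : M → 𝕜) (x : M) (c : ℝ) (u v : TangentSpace (𝓡 m) x) :
    hessian f x u (c • v) = c • hessian f x u v :=
  coordHessian_smul_right _ _ _ _ _ _ _

theorem bilinearComp_innerSL {E V : Type*} [NormedAddCommGroup E] [NormedSpace ℝ E]
    [NormedAddCommGroup V] [InnerProductSpace ℝ V] (A : E →L[ℝ] V) (u v : E) :
    (innerSL ℝ (E := V)).bilinearComp A A u v = inner ℝ (A u) (A v) := by
  simp

theorem chartMetric_def (x₀ : M) (y u v : EuclideanSpace ℝ (Fin m)) :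
    chartMetric x₀ y u v = inner ℝ
      (mfderiv 𝓘(ℝ, EuclideanSpace ℝ (Fin m)) (𝓡 m) (extChartAt (𝓡 m) x₀).symm y u)
      (mfderiv 𝓘(ℝ, EuclideanSpace ℝ (Fin m)) (𝓡 m) (extChartAt (𝓡 m) x₀).symm y v) :=
  bilinearComp_innerSL (V := TangentSpace (𝓡 m) ((extChartAt (𝓡 m) x₀).symm y)) _ u v

theorem chartMetric_symm (x₀ : M) (y u v : EuclideanSpace ℝ (Fin m)) :
    chartMetric x₀ y u v = chartMetric x₀ y v u := by
  rw [chartMetric_def, chartMetric_def]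
  exact real_inner_comm _ _

variable [IsManifold (𝓡 m) ∞ M]

theorem chartMetric_apply {x₀ p : M} (hp : p ∈ (extChartAt (𝓡 m) x₀).source)
    (u v : TangentSpace (𝓡 m) p) :
    chartMetric x₀ (extChartAt (𝓡 m) x₀ p) (coordD x₀ p u) (coordD x₀ p v) = inner ℝ u v := by
  obtain ⟨y, hy, rfl⟩ : ∃ y ∈ (extChartAt (𝓡 m) x₀).target, (extChartAt (𝓡 m) x₀).symm y = p :=
    ⟨_, (extChartAt (𝓡 m) x₀).map_source hp, (extChartAt (𝓡 m) x₀).left_inv hp⟩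
  rw [(extChartAt (𝓡 m) x₀).right_inv hy]
  rw [chartMetric_def]
  exact congrArg₂ (fun a b => inner ℝ a b) (mfderiv_symm_coordD hy u) (mfderiv_symm_coordD hy v)

theorem chartMetric_self (p : M) (u v : TangentSpace (𝓡 m) p) :
    chartMetric p (extChartAt (𝓡 m) p p) u v = inner ℝ u v := by
  have := chartMetric_apply (mem_extChartAt_source (I := 𝓡 m) p) u v
  rwa [coordD_self, coordD_self] at this

theorem contDiffOn_chartMetric
    [IsContMDiffRiemannianBundle (𝓡 m) ∞ (EuclideanSpace ℝ (Fin m))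
      (fun x : M => TangentSpace (𝓡 m) x)] (x₀ : M) :
    ContDiffOn ℝ ∞ (chartMetric x₀) (extChartAt (𝓡 m) x₀).target := by
  rw [contDiffOn_clm_apply]
  intro v
  rw [contDiffOn_clm_apply]
  intro w
  have hs : ∀ v : EuclideanSpace ℝ (Fin m), ContMDiffOn (𝓡 m) ((𝓡 m).prod 𝓘(ℝ, EuclideanSpace ℝ (Fin m))) ∞
      (fun x : M => TotalSpace.mk' (EuclideanSpace ℝ (Fin m)) x
        ((trivializationAt (EuclideanSpace ℝ (Fin m)) (TangentSpace (𝓡 m)) x₀).symm x v))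
      (chartAt (EuclideanSpace ℝ (Fin m)) x₀).source := by
    intro v
    have := (trivializationAt (EuclideanSpace ℝ (Fin m)) (TangentSpace (𝓡 m) (M := M)) x₀).contMDiffOn_section_baseSet_iff (IB := 𝓡 m) (n := ∞) (s := fun x => (trivializationAt (EuclideanSpace ℝ (Fin m)) (TangentSpace (𝓡 m)) x₀).symm x v)
    refine this.2 ((contMDiffOn_const (c := v)).congr ?_)
    intro x hx
    rw [Trivialization.apply_mk_symm _ hx]
  have h2 : ContMDiffOn (𝓡 m) 𝓘(ℝ) ∞ (fun x : M => inner ℝ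
      ((trivializationAt (EuclideanSpace ℝ (Fin m)) (TangentSpace (𝓡 m)) x₀).symm x v)
      ((trivializationAt (EuclideanSpace ℝ (Fin m)) (TangentSpace (𝓡 m)) x₀).symm x w))
      (chartAt (EuclideanSpace ℝ (Fin m)) x₀).source :=
    ContMDiffOn.inner_bundle (F := EuclideanSpace ℝ (Fin m)) (b := fun x => x) (hs v) (hs w)
  have h3 := h2.comp (contMDiffOn_extChartAt_symm (I := 𝓡 m) x₀) (by
    intro y hy
    have := (extChartAt (𝓡 m) x₀).map_target hy
    rwa [extChartAt_source] at this)
  refine (contMDiffOn_iff_contDiffOn.1 h3).congr ?_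
  intro y hy
  have hy' : (extChartAt (𝓡 m) x₀).symm y ∈ (chartAt (EuclideanSpace ℝ (Fin m)) x₀).source := by
    have := (extChartAt (𝓡 m) x₀).map_target hy
    rwa [extChartAt_source] at this
  have := TangentBundle.symmL_trivializationAt (I := 𝓡 m) hy'
  rw [(extChartAt (𝓡 m) x₀).right_inv hy] at this
  simp only [ModelWithCorners.range_eq_univ, mfderivWithin_univ] at this
  rw [chartMetric_def]
  rw [← this]
  have e : ∀ v, (trivializationAt (EuclideanSpace ℝ (Fin m)) (TangentSpace (𝓡 m)) x₀).symmL ℝ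
      ((extChartAt (𝓡 m) x₀).symm y) v =
      (trivializationAt (EuclideanSpace ℝ (Fin m)) (TangentSpace (𝓡 m)) x₀).symm
      ((extChartAt (𝓡 m) x₀).symm y) v := fun v => Trivialization.symmL_apply _ hy' _
  exact congrArg₂ (fun a b => inner ℝ a b) (e v) (e w)

end Pointwise

/-! ## The Hessian in charts -/

section Pointwise

variable {m : ℕ} {M : Type*} [TopologicalSpace M] [ChartedSpace (EuclideanSpace ℝ (Fin m)) M]
  [IsManifold (𝓡 m) ∞ M]
  {F : Type*} [NormedAddCommGroup F] [NormedSpace ℝ F]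

theorem contDiffOn_coord {f : M → F} (hf : ContMDiff (𝓡 m) 𝓘(ℝ, F) ∞ f) (x₀ : M) :
    ContDiffOn ℝ ∞ (f ∘ (extChartAt (𝓡 m) x₀).symm) (extChartAt (𝓡 m) x₀).target :=
  contMDiffOn_iff_contDiffOn.1 (hf.comp_contMDiffOn (contMDiffOn_extChartAt_symm x₀))

theorem contDiffAt_coord {f : M → F} (hf : ContMDiff (𝓡 m) 𝓘(ℝ, F) ∞ f) {x₀ p : M}
    (hp : p ∈ (extChartAt (𝓡 m) x₀).source) :
    ContDiffAt ℝ ∞ (f ∘ (extChartAt (𝓡 m) x₀).symm) (extChartAt (𝓡 m) x₀ p) :=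
  (contDiffOn_coord hf x₀).contDiffAt
    ((isOpen_extChartAt_target x₀).mem_nhds ((extChartAt (𝓡 m) x₀).map_source hp))

/-- Chain rule: if `f = g ∘ φ` near `p`, then `df = dg ∘ dφ` at `p`. -/
theorem mvfderiv_of_comp {f : M → F} {g : EuclideanSpace ℝ (Fin m) → F} {x₀ p : M}
    (hp : p ∈ (extChartAt (𝓡 m) x₀).source)
    (hg : DifferentiableAt ℝ g (extChartAt (𝓡 m) x₀ p))
    (h : f =ᶠ[𝓝 p] g ∘ extChartAt (𝓡 m) x₀) (a : TangentSpace (𝓡 m) p) :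
    mvfderiv (𝓡 m) f p a = fderiv ℝ g (extChartAt (𝓡 m) x₀ p) (coordD x₀ p a) := by
  have h1 := h.mfderiv_eq (I := 𝓡 m) (I' := 𝓘(ℝ, F))
  have hφ : MDifferentiableAt (𝓡 m) 𝓘(ℝ, EuclideanSpace ℝ (Fin m)) (extChartAt (𝓡 m) x₀) p :=
    mdifferentiableAt_extChartAt (by rwa [extChartAt_source] at hp)
  have h2 := mfderiv_comp p hg.mdifferentiableAt hφ
  have h3 := h1.trans h2
  rw [mfderiv_eq_fderiv] at h3
  exact congrArg (fun L => L a) h3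

theorem fderiv_coord {f : M → F} (hf : ContMDiff (𝓡 m) 𝓘(ℝ, F) ∞ f) {x₀ p : M}
    (hp : p ∈ (extChartAt (𝓡 m) x₀).source) (a : TangentSpace (𝓡 m) p) :
    mvfderiv (𝓡 m) f p a =
      fderiv ℝ (f ∘ (extChartAt (𝓡 m) x₀).symm) (extChartAt (𝓡 m) x₀ p) (coordD x₀ p a) := by
  refine mvfderiv_of_comp hp ((contDiffAt_coord hf hp).differentiableAt (by simp)) ?_ a
  filter_upwards [(isOpen_extChartAt_source (I := 𝓡 m) x₀).mem_nhds hp] with r hr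
  simp only [Function.comp, (extChartAt (𝓡 m) x₀).left_inv hr]

theorem contDiffAt_transition {x₀ p r : M} (hr : r ∈ (extChartAt (𝓡 m) x₀).source)
    (hr' : r ∈ (extChartAt (𝓡 m) p).source) :
    ContDiffAt ℝ ∞ (extChartAt (𝓡 m) x₀ ∘ (extChartAt (𝓡 m) p).symm) (extChartAt (𝓡 m) p r) := by
  refine contMDiffAt_iff_contDiffAt.1 (ContMDiffAt.comp _ ?_ ?_ (I' := 𝓡 m))
  · rw [(extChartAt (𝓡 m) p).left_inv hr']
    exact contMDiffAt_extChartAt' (by rwa [extChartAt_source] at hr)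
  · exact (contMDiffOn_extChartAt_symm p).contMDiffAt
      ((isOpen_extChartAt_target p).mem_nhds ((extChartAt (𝓡 m) p).map_source hr'))

theorem coordD_transition {x₀ p r : M} (hr : r ∈ (extChartAt (𝓡 m) x₀).source)
    (hr' : r ∈ (extChartAt (𝓡 m) p).source) (a : TangentSpace (𝓡 m) r) :
    coordD x₀ r a = fderiv ℝ (extChartAt (𝓡 m) x₀ ∘ (extChartAt (𝓡 m) p).symm)
      (extChartAt (𝓡 m) p r) (coordD p r a) := by
  refine mvfderiv_of_comp hr' ((contDiffAt_transition hr hr').differentiableAt (by simp)) ?_ a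
  filter_upwards [(isOpen_extChartAt_source (I := 𝓡 m) p).mem_nhds hr'] with s hs
  simp only [Function.comp, (extChartAt (𝓡 m) p).left_inv hs]

variable [RiemannianBundle (fun x : M => TangentSpace (𝓡 m) x)]

theorem chartMetric_transition {x₀ p : M} (hp : p ∈ (extChartAt (𝓡 m) x₀).source) :
    chartMetric p =ᶠ[𝓝 (extChartAt (𝓡 m) p p)] fun z =>
      (chartMetric x₀ ((extChartAt (𝓡 m) x₀ ∘ (extChartAt (𝓡 m) p).symm) z)).bilinearComp
        (fderiv ℝ (extChartAt (𝓡 m) x₀ ∘ (extChartAt (𝓡 m) p).symm) z)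
        (fderiv ℝ (extChartAt (𝓡 m) x₀ ∘ (extChartAt (𝓡 m) p).symm) z) := by
  have h1 : ∀ᶠ z in 𝓝 (extChartAt (𝓡 m) p p), z ∈ (extChartAt (𝓡 m) p).target :=
    (isOpen_extChartAt_target p).mem_nhds (mem_extChartAt_target p)
  have h2 : ∀ᶠ z in 𝓝 (extChartAt (𝓡 m) p p),
      (extChartAt (𝓡 m) p).symm z ∈ (extChartAt (𝓡 m) x₀).source := by
    refine (continuousAt_extChartAt_symm p).eventually ?_
    rw [extChartAt_to_inv]
    exact (isOpen_extChartAt_source x₀).mem_nhds hp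
  filter_upwards [h1, h2] with z hz hz2
  obtain ⟨r, hr, rfl⟩ : ∃ r ∈ (extChartAt (𝓡 m) p).source, extChartAt (𝓡 m) p r = z :=
    ⟨_, (extChartAt (𝓡 m) p).map_target hz, (extChartAt (𝓡 m) p).right_inv hz⟩
  rw [(extChartAt (𝓡 m) p).left_inv hr] at hz2
  ext1 u
  ext1 v
  obtain ⟨a, rfl⟩ := coordD_surjective hr u
  obtain ⟨b, rfl⟩ := coordD_surjective hr v
  rw [ContinuousLinearMap.bilinearComp_apply, ← coordD_transition hz2 hr, ← coordD_transition hz2 hr,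
    Function.comp, (extChartAt (𝓡 m) p).left_inv hr, chartMetric_apply hr, chartMetric_apply hz2]

variable [IsContMDiffRiemannianBundle (𝓡 m) ∞ (EuclideanSpace ℝ (Fin m))
      (fun x : M => TangentSpace (𝓡 m) x)]

theorem differentiableAt_chartMetric {x₀ p : M} (hp : p ∈ (extChartAt (𝓡 m) x₀).source) :
    DifferentiableAt ℝ (chartMetric x₀) (extChartAt (𝓡 m) x₀ p) :=
  ((contDiffOn_chartMetric x₀).contDiffAt
    ((isOpen_extChartAt_target x₀).mem_nhds ((extChartAt (𝓡 m) x₀).map_source hp))).differentiableAt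
    (by simp)

variable {𝕜 : Type*} [RCLike 𝕜]

/-- The Hessian does not depend on the chart in which it is computed. -/
theorem hessian_eq_chart {f : M → 𝕜} (hf : ContMDiff (𝓡 m) 𝓘(ℝ, 𝕜) ∞ f) {x₀ p : M}
    (hp : p ∈ (extChartAt (𝓡 m) x₀).source) (u v : TangentSpace (𝓡 m) p) :
    hessian f p u v = fderiv ℝ (fderiv ℝ (f ∘ (extChartAt (𝓡 m) x₀).symm)) (extChartAt (𝓡 m) x₀ p)
        (coordD x₀ p u) (coordD x₀ p v)
      - ∑ k, christoffel (chartMetric x₀) (extChartAt (𝓡 m) x₀ p) (coordD x₀ p u) (coordD x₀ p v)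
          (coordD x₀ p (tangentBasis m p k)) •
        fderiv ℝ (f ∘ (extChartAt (𝓡 m) x₀).symm) (extChartAt (𝓡 m) x₀ p)
          (coordD x₀ p (tangentBasis m p k)) := by
  have hpp := mem_extChartAt_source (I := 𝓡 m) p
  have hψy : (extChartAt (𝓡 m) x₀ ∘ (extChartAt (𝓡 m) p).symm) (extChartAt (𝓡 m) p p) =
      extChartAt (𝓡 m) x₀ p := by simp
  have hL : ∀ a : TangentSpace (𝓡 m) p, fderiv ℝ (extChartAt (𝓡 m) x₀ ∘ (extChartAt (𝓡 m) p).symm)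
      (extChartAt (𝓡 m) p p) a = coordD x₀ p a := by
    intro a
    rw [coordD_transition hp hpp, coordD_self]
  have key := hessian_coord_change (f := f ∘ (extChartAt (𝓡 m) x₀).symm)
    (f' := f ∘ (extChartAt (𝓡 m) p).symm) (G := chartMetric x₀) (G' := chartMetric p)
    (ψ := extChartAt (𝓡 m) x₀ ∘ (extChartAt (𝓡 m) p).symm) (y := extChartAt (𝓡 m) p p)
    (by rw [hψy]; exact (contDiffAt_coord hf hp).of_le ENat.LEInfty.out)
    ((contDiffAt_transition hp hpp).of_le ENat.LEInfty.out)
    (by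
      have h2 : ∀ᶠ z in 𝓝 (extChartAt (𝓡 m) p p),
          (extChartAt (𝓡 m) p).symm z ∈ (extChartAt (𝓡 m) x₀).source := by
        refine (continuousAt_extChartAt_symm p).eventually ?_
        rw [extChartAt_to_inv]
        exact (isOpen_extChartAt_source x₀).mem_nhds hp
      filter_upwards [h2] with z hz
      simp only [Function.comp, (extChartAt (𝓡 m) x₀).left_inv hz])
    (by rw [hψy]; exact differentiableAt_chartMetric hp)
    (chartMetric_transition hp)
    (differentiableAt_chartMetric hpp)
    (fun a b => chartMetric_symm _ _ _ _)
    (fun k => tangentBasis m p k)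
    (by
      intro a
      rw [hψy]
      obtain ⟨a', rfl⟩ := coordD_surjective hp a
      simp only [hL, chartMetric_apply hp]
      conv_rhs => rw [← (tangentBasis m p).sum_repr' a']
      rw [map_sum]
      exact Finset.sum_congr rfl fun k _ => by rw [map_smul, real_inner_comm])
    u v
  rw [hψy] at key
  simp only [hL] at key
  exact key

end Pointwise

/-! ## Norms of derivatives, the Laplacian -/

/-- The real part of the Hermitian product, as a real bilinear form. -/
def reMul (𝕜 : Type*) [RCLike 𝕜] : 𝕜 →ₗ[ℝ] 𝕜 →ₗ[ℝ] ℝ :=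
  LinearMap.mk₂ ℝ (fun a b => RCLike.re (star a * b))
    (fun a b c => by simp [add_mul]) (fun r a b => by simp [RCLike.smul_re])
    (fun a b c => by simp [mul_add]) (fun r a b => by simp [RCLike.smul_re])

theorem reMul_self {𝕜 : Type*} [RCLike 𝕜] (a : 𝕜) : reMul 𝕜 a a = ‖a‖ ^ 2 := by
  simp only [reMul, LinearMap.mk₂_apply, RCLike.star_def, RCLike.conj_mul]
  norm_cast

theorem continuous_reMul (𝕜 : Type*) [RCLike 𝕜] : Continuous fun z : 𝕜 × 𝕜 => reMul 𝕜 z.1 z.2 := by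
  simp only [reMul, LinearMap.mk₂_apply]
  exact RCLike.continuous_re.comp ((continuous_star.comp continuous_fst).mul continuous_snd)

section Pointwise

variable {m : ℕ} {M : Type*} [TopologicalSpace M] [ChartedSpace (EuclideanSpace ℝ (Fin m)) M]
  [RiemannianBundle (fun x : M => TangentSpace (𝓡 m) x)]

/-- The matrix `(g_ij)` of the metric in the preferred chart at `x₀`. -/
def chartGram (x₀ : M) (y : EuclideanSpace ℝ (Fin m)) : Matrix (Fin m) (Fin m) ℝ :=
  Matrix.of fun i j => chartMetric x₀ y (EuclideanSpace.single i 1) (EuclideanSpace.single j 1)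

variable {𝕜 : Type*} [RCLike 𝕜]

/-- The pointwise norm `|df|` with respect to the Riemannian metric (complexified if `𝕜 = ℂ`). -/
def gradNorm (m : ℕ) {M : Type*} [TopologicalSpace M] [ChartedSpace (EuclideanSpace ℝ (Fin m)) M]
    [RiemannianBundle (fun x : M => TangentSpace (𝓡 m) x)] {𝕜 : Type*} [RCLike 𝕜]
    (f : M → 𝕜) (x : M) : ℝ := √(∑ k, ‖mvfderiv (𝓡 m) f x (tangentBasis m x k)‖ ^ 2)

/-- The pointwise (Hilbert-Schmidt) norm `|∇df|` of the Hessian with respect to the Riemannian metric. -/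
def hessianNorm (m : ℕ) {M : Type*} [TopologicalSpace M] [ChartedSpace (EuclideanSpace ℝ (Fin m)) M]
    [RiemannianBundle (fun x : M => TangentSpace (𝓡 m) x)] {𝕜 : Type*} [RCLike 𝕜]
    (f : M → 𝕜) (x : M) : ℝ :=
  √(∑ i, ∑ j, ‖hessian f x (tangentBasis m x i) (tangentBasis m x j)‖ ^ 2)

/-- The Laplace-Beltrami operator `Δf = tr ∇df = div grad f = -d†df`. -/
def laplacian (m : ℕ) {M : Type*} [TopologicalSpace M] [ChartedSpace (EuclideanSpace ℝ (Fin m)) M]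
    [RiemannianBundle (fun x : M => TangentSpace (𝓡 m) x)] {𝕜 : Type*} [RCLike 𝕜]
    (f : M → 𝕜) (x : M) : 𝕜 := ∑ k, hessian f x (tangentBasis m x k) (tangentBasis m x k)

/-- The Hessian in the preferred chart at `x₀`, in terms of the inverse matrix `(g^ij)`. -/
def chartHessian (f : M → 𝕜) (x₀ : M) (y u v : EuclideanSpace ℝ (Fin m)) : 𝕜 :=
  fderiv ℝ (fderiv ℝ (f ∘ (extChartAt (𝓡 m) x₀).symm)) y u v
    - ∑ i, ∑ j, (chartGram x₀ y)⁻¹ i j • christoffel (chartMetric x₀) y u v (EuclideanSpace.single i 1) •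
        fderiv ℝ (f ∘ (extChartAt (𝓡 m) x₀).symm) y (EuclideanSpace.single j 1)

variable [IsManifold (𝓡 m) ∞ M]

/-- The coordinate vector fields at `p`. -/
theorem exists_coordinate_frame {x₀ p : M} (hp : p ∈ (extChartAt (𝓡 m) x₀).source) :
    ∃ c : Fin m → TangentSpace (𝓡 m) p, (∀ i, coordD x₀ p (c i) = EuclideanSpace.single i 1) ∧
      (Matrix.of fun i j => inner ℝ (c i) (c j)) = chartGram x₀ (extChartAt (𝓡 m) x₀ p) ∧
      IsUnit (chartGram x₀ (extChartAt (𝓡 m) x₀ p)).det := by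
  choose c hc using fun i : Fin m => coordD_surjective hp (EuclideanSpace.single i (1 : ℝ))
  have hg : (Matrix.of fun i j => inner ℝ (c i) (c j)) =
      chartGram x₀ (extChartAt (𝓡 m) x₀ p) := by
    ext i j
    simp only [chartGram, Matrix.of_apply, ← hc, chartMetric_apply hp]
  refine ⟨c, hc, hg, ?_⟩
  have hli : LinearIndependent ℝ c := by
    have h1 : LinearIndependent ℝ fun i : Fin m => (EuclideanSpace.single i (1 : ℝ)) := by
      have := (EuclideanSpace.basisFun (Fin m) ℝ).orthonormal.linearIndependent
      rwa [show ⇑(EuclideanSpace.basisFun (Fin m) ℝ) = fun i => EuclideanSpace.single i 1 from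
        funext fun i => EuclideanSpace.basisFun_apply _ _ i] at this
    have h2 : (fun i : Fin m => (EuclideanSpace.single i (1 : ℝ))) = coordD x₀ p ∘ c :=
      funext fun i => (hc i).symm
    rw [h2] at h1
    exact LinearIndependent.of_comp (coordD x₀ p).toLinearMap h1
  rw [← hg]
  exact isUnit_iff_ne_zero.2 (Matrix.posDef_gram_of_linearIndependent hli).det_pos.ne'

theorem gradNorm_sq_eq {f : M → 𝕜} (hf : ContMDiff (𝓡 m) 𝓘(ℝ, 𝕜) ∞ f) {x₀ p : M}
    (hp : p ∈ (extChartAt (𝓡 m) x₀).source) :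
    ∑ k, ‖mvfderiv (𝓡 m) f p (tangentBasis m p k)‖ ^ 2 =
      ∑ i, ∑ j, (chartGram x₀ (extChartAt (𝓡 m) x₀ p))⁻¹ i j *
        reMul 𝕜 (fderiv ℝ (f ∘ (extChartAt (𝓡 m) x₀).symm) (extChartAt (𝓡 m) x₀ p)
            (EuclideanSpace.single i 1))
          (fderiv ℝ (f ∘ (extChartAt (𝓡 m) x₀).symm) (extChartAt (𝓡 m) x₀ p)
            (EuclideanSpace.single j 1)) := by
  obtain ⟨c, hc, hg, hu⟩ := exists_coordinate_frame hp
  have := sum_orthonormal (tangentBasis m p) c (by rwa [hg])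
    ((reMul 𝕜).compl₁₂ (mvfderiv (𝓡 m) f p).toLinearMap (mvfderiv (𝓡 m) f p).toLinearMap)
  rw [hg] at this
  simp only [LinearMap.compl₁₂_apply, ContinuousLinearMap.coe_coe, reMul_self, smul_eq_mul] at this
  rw [this]
  simp only [fderiv_coord hf hp, hc]

variable [IsContMDiffRiemannianBundle (𝓡 m) ∞ (EuclideanSpace ℝ (Fin m))
      (fun x : M => TangentSpace (𝓡 m) x)]

theorem hessian_eq_chartHessian {f : M → 𝕜} (hf : ContMDiff (𝓡 m) 𝓘(ℝ, 𝕜) ∞ f) {x₀ p : M}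
    (hp : p ∈ (extChartAt (𝓡 m) x₀).source) (u v : TangentSpace (𝓡 m) p) :
    hessian f p u v = chartHessian f x₀ (extChartAt (𝓡 m) x₀ p) (coordD x₀ p u) (coordD x₀ p v) := by
  obtain ⟨c, hc, hg, hu⟩ := exists_coordinate_frame hp
  have := sum_orthonormal (tangentBasis m p) c (by rwa [hg])
    (LinearMap.mk₂ ℝ (fun a b : TangentSpace (𝓡 m) p =>
      christoffel (chartMetric x₀) (extChartAt (𝓡 m) x₀ p) (coordD x₀ p u) (coordD x₀ p v)
          (coordD x₀ p a) • fderiv ℝ (f ∘ (extChartAt (𝓡 m) x₀).symm) (extChartAt (𝓡 m) x₀ p)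
          (coordD x₀ p b))
      (fun a b c => by rw [map_add, christoffel_add_right, add_smul])
      (fun r a b => by rw [map_smul, christoffel_smul_right, mul_smul])
      (fun a b c => by rw [map_add, map_add, smul_add])
      (fun r a b => by rw [map_smul, map_smul, smul_comm]))
  rw [hg] at this
  simp only [LinearMap.mk₂_apply, hc] at this
  rw [hessian_eq_chart hf hp, this, chartHessian]

theorem hessianNorm_sq_eq {f : M → 𝕜} (hf : ContMDiff (𝓡 m) 𝓘(ℝ, 𝕜) ∞ f) {x₀ p : M}
    (hp : p ∈ (extChartAt (𝓡 m) x₀).source) :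
    ∑ k, ∑ l, ‖hessian f p (tangentBasis m p k) (tangentBasis m p l)‖ ^ 2 =
      ∑ i, ∑ j, (chartGram x₀ (extChartAt (𝓡 m) x₀ p))⁻¹ i j *
        ∑ i', ∑ j', (chartGram x₀ (extChartAt (𝓡 m) x₀ p))⁻¹ i' j' *
        reMul 𝕜 (chartHessian f x₀ (extChartAt (𝓡 m) x₀ p)
            (EuclideanSpace.single i 1) (EuclideanSpace.single i' 1))
          (chartHessian f x₀ (extChartAt (𝓡 m) x₀ p)
            (EuclideanSpace.single j 1) (EuclideanSpace.single j' 1)) := by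
  obtain ⟨c, hc, hg, hu⟩ := exists_coordinate_frame hp
  have h1 := fun l => sum_orthonormal (tangentBasis m p) c (by rwa [hg])
    (LinearMap.mk₂ ℝ (fun a b => reMul 𝕜 (hessian f p a (tangentBasis m p l))
        (hessian f p b (tangentBasis m p l)))
      (fun a b c => by rw [hessian_add_left, map_add, LinearMap.add_apply])
      (fun r a b => by rw [hessian_smul_left, map_smul, LinearMap.smul_apply])
      (fun a b c => by rw [hessian_add_left, map_add])
      (fun r a b => by rw [hessian_smul_left, map_smul]))
  have h2 := fun i j => sum_orthonormal (tangentBasis m p) c (by rwa [hg])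
    (LinearMap.mk₂ ℝ (fun a b => reMul 𝕜 (hessian f p (c i) a) (hessian f p (c j) b))
      (fun a b c => by rw [hessian_add_right, map_add, LinearMap.add_apply])
      (fun r a b => by rw [hessian_smul_right, map_smul, LinearMap.smul_apply])
      (fun a b c => by rw [hessian_add_right, map_add])
      (fun r a b => by rw [hessian_smul_right, map_smul]))
  simp only [hg, LinearMap.mk₂_apply,
    reMul_self, smul_eq_mul] at h1 h2
  rw [Finset.sum_comm]
  simp only [h1]
  rw [Finset.sum_comm]
  refine Finset.sum_congr rfl fun i _ => ?_
  rw [Finset.sum_comm]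
  refine Finset.sum_congr rfl fun j _ => ?_
  rw [← Finset.mul_sum, h2]
  simp only [hessian_eq_chartHessian hf hp, hc]

theorem continuousOn_chartGram (x₀ : M) :
    ContinuousOn (chartGram (m := m) x₀) (extChartAt (𝓡 m) x₀).target := by
  refine continuousOn_pi.2 fun i => continuousOn_pi.2 fun j => ?_
  exact ((contDiffOn_chartMetric (m := m) x₀).continuousOn.clm_apply continuousOn_const).clm_apply
    continuousOn_const

theorem continuousOn_chartGram_inv (x₀ : M) (i j : Fin m) :
    ContinuousOn (fun y => (chartGram x₀ y)⁻¹ i j) (extChartAt (𝓡 m) x₀).target := by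
  have h1 := continuousOn_chartGram (m := m) x₀
  intro y hy
  have hu : IsUnit (chartGram x₀ y).det := by
    obtain ⟨c, hc, hg, hu⟩ := exists_coordinate_frame (m := m) ((extChartAt (𝓡 m) x₀).map_target hy)
    rwa [(extChartAt (𝓡 m) x₀).right_inv hy] at hu
  have h2 : ContinuousWithinAt (fun y => (chartGram x₀ y)⁻¹) (extChartAt (𝓡 m) x₀).target y :=
    (continuousAt_matrix_inv _ (by
      rw [Ring.inverse_eq_inv']
      exact continuousAt_inv₀ hu.ne_zero)).comp_continuousWithinAt (h1 y hy)
  exact continuousWithinAt_pi.1 (continuousWithinAt_pi.1 h2 i) j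

theorem continuousOn_christoffel (x₀ : M) (u v w : EuclideanSpace ℝ (Fin m)) :
    ContinuousOn (fun y => christoffel (chartMetric x₀) y u v w) (extChartAt (𝓡 m) x₀).target :=
  continuousOn_christoffel_of (contDiffOn_chartMetric (m := m) x₀) (isOpen_extChartAt_target x₀) u v w

theorem continuousOn_chartHessian {f : M → 𝕜} (hf : ContMDiff (𝓡 m) 𝓘(ℝ, 𝕜) ∞ f) (x₀ : M)
    (u v : EuclideanSpace ℝ (Fin m)) :
    ContinuousOn (fun y => chartHessian f x₀ y u v) (extChartAt (𝓡 m) x₀).target := by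
  have h1 := (contDiffOn_coord hf x₀).continuousOn_fderiv_of_isOpen (isOpen_extChartAt_target x₀)
    (by simp)
  have h2 := ((contDiffOn_coord hf x₀).fderiv_of_isOpen (isOpen_extChartAt_target x₀)
    (m := 1) (by norm_num; exact ENat.LEInfty.out)).continuousOn_fderiv_of_isOpen (isOpen_extChartAt_target x₀)
    (by simp)
  refine ((h2.clm_apply continuousOn_const).clm_apply continuousOn_const).sub ?_
  refine continuousOn_finsetSum _ fun i _ => continuousOn_finsetSum _ fun j _ => ?_
  exact (continuousOn_chartGram_inv x₀ i j).smul
    ((continuousOn_christoffel x₀ u v _).smul (h1.clm_apply continuousOn_const))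

theorem continuous_gradNorm {f : M → 𝕜} (hf : ContMDiff (𝓡 m) 𝓘(ℝ, 𝕜) ∞ f) :
    Continuous (gradNorm m f) := by
  refine Real.continuous_sqrt.comp (continuous_of_chart (G := fun x₀ y => ∑ i, ∑ j,
      (chartGram x₀ y)⁻¹ i j *
        reMul 𝕜 (fderiv ℝ (f ∘ (extChartAt (𝓡 m) x₀).symm) y (EuclideanSpace.single i 1))
          (fderiv ℝ (f ∘ (extChartAt (𝓡 m) x₀).symm) y (EuclideanSpace.single j 1)))
    (fun x₀ => ?_) fun x₀ p hp => gradNorm_sq_eq hf hp)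
  have h1 := (contDiffOn_coord hf x₀).continuousOn_fderiv_of_isOpen (isOpen_extChartAt_target x₀)
    (by simp)
  refine continuousOn_finsetSum _ fun i _ => continuousOn_finsetSum _ fun j _ => ?_
  exact (continuousOn_chartGram_inv x₀ i j).mul ((continuous_reMul 𝕜).comp_continuousOn
    ((h1.clm_apply continuousOn_const).prodMk (h1.clm_apply continuousOn_const)))

theorem continuous_hessianNorm {f : M → 𝕜} (hf : ContMDiff (𝓡 m) 𝓘(ℝ, 𝕜) ∞ f) :
    Continuous (hessianNorm m f) := by
  refine Real.continuous_sqrt.comp (continuous_of_chart (G := fun x₀ y => ∑ i, ∑ j,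
      (chartGram x₀ y)⁻¹ i j * ∑ i', ∑ j', (chartGram x₀ y)⁻¹ i' j' *
        reMul 𝕜 (chartHessian f x₀ y (EuclideanSpace.single i 1) (EuclideanSpace.single i' 1))
          (chartHessian f x₀ y (EuclideanSpace.single j 1) (EuclideanSpace.single j' 1)))
    (fun x₀ => ?_) fun x₀ p hp => hessianNorm_sq_eq hf hp)
  refine continuousOn_finsetSum _ fun i _ => continuousOn_finsetSum _ fun j _ => ?_
  refine (continuousOn_chartGram_inv x₀ i j).mul ?_
  refine continuousOn_finsetSum _ fun i' _ => continuousOn_finsetSum _ fun j' _ => ?_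
  exact (continuousOn_chartGram_inv x₀ i' j').mul ((continuous_reMul 𝕜).comp_continuousOn
    ((continuousOn_chartHessian hf x₀ _ _).prodMk (continuousOn_chartHessian hf x₀ _ _)))

end Pointwise

/-! ## The Riemannian volume measure -/

section Gram

variable {m : ℕ} {M : Type*} [TopologicalSpace M] [ChartedSpace (EuclideanSpace ℝ (Fin m)) M]
  [RiemannianBundle (fun x : M => TangentSpace (𝓡 m) x)] [IsManifold (𝓡 m) ∞ M]

theorem chartGram_transition {x₀ p r : M} (hr : r ∈ (extChartAt (𝓡 m) x₀).source)
    (hr' : r ∈ (extChartAt (𝓡 m) p).source) :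
    √(chartGram p (extChartAt (𝓡 m) p r)).det =
      |(fderiv ℝ (extChartAt (𝓡 m) x₀ ∘ (extChartAt (𝓡 m) p).symm) (extChartAt (𝓡 m) p r)).det| *
        √(chartGram x₀ (extChartAt (𝓡 m) x₀ r)).det := by
  set L := fderiv ℝ (extChartAt (𝓡 m) x₀ ∘ (extChartAt (𝓡 m) p).symm) (extChartAt (𝓡 m) p r) with hL
  have h1 : ∀ u v, chartMetric p (extChartAt (𝓡 m) p r) u v =
      chartMetric x₀ (extChartAt (𝓡 m) x₀ r) (L u) (L v) := by
    intro u v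
    obtain ⟨a, rfl⟩ := coordD_surjective hr' u
    obtain ⟨b, rfl⟩ := coordD_surjective hr' v
    rw [hL, ← coordD_transition hr hr', ← coordD_transition hr hr', chartMetric_apply hr,
      chartMetric_apply hr']
  let B := (EuclideanSpace.basisFun (Fin m) ℝ).toBasis
  have hB : ∀ i, B i = EuclideanSpace.single i 1 := fun i => by simp [B]
  let A := LinearMap.toMatrix B B L.toLinearMap
  have hA : ∀ i, L (EuclideanSpace.single i 1) = ∑ k, A k i • EuclideanSpace.single k (1 : ℝ) := by
    intro i
    have := B.sum_repr (L (B i))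
    simp only [hB] at this
    rw [← this]
    refine Finset.sum_congr rfl fun k _ => ?_
    simp [A, LinearMap.toMatrix_apply, hB]
  have h2 : chartGram p (extChartAt (𝓡 m) p r) =
      A.transpose * chartGram x₀ (extChartAt (𝓡 m) x₀ r) * A := by
    ext i j
    simp only [chartGram, Matrix.of_apply, h1, hA, Matrix.mul_apply, Matrix.transpose_apply, map_sum,
      map_smul, sum_apply, smul_apply, smul_eq_mul, Finset.sum_mul, Finset.mul_sum]
    exact Finset.sum_congr rfl fun k _ => Finset.sum_congr rfl fun l _ => by ring
  have hdet : A.det = L.det := LinearMap.det_toMatrix B _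
  rw [h2, Matrix.det_mul, Matrix.det_mul, Matrix.det_transpose, hdet,
    show L.det * (chartGram x₀ (extChartAt (𝓡 m) x₀ r)).det * L.det =
      L.det ^ 2 * (chartGram x₀ (extChartAt (𝓡 m) x₀ r)).det by ring,
    Real.sqrt_mul (sq_nonneg _), Real.sqrt_sq_eq_abs]

end Gram

section Volume

variable {m : ℕ} {M : Type*} [TopologicalSpace M] [ChartedSpace (EuclideanSpace ℝ (Fin m)) M]
  [RiemannianBundle (fun x : M => TangentSpace (𝓡 m) x)] [MeasurableSpace M]

/-- The measure `√det (g_ij) dy` on the domain of the preferred chart at `x₀`, extended by zero to `M`. -/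
def chartVolume (x₀ : M) : Measure M :=
  (((volume : Measure (EuclideanSpace ℝ (Fin m))).restrict (extChartAt (𝓡 m) x₀).target).withDensity
    fun y => ENNReal.ofReal √(chartGram x₀ y).det).map (extChartAt (𝓡 m) x₀).symm

/-- The Riemannian volume measure: the least measure that dominates the volume measures of all charts.
By `riemannianVolume_apply` it equals `√det (g_ij) dy` on every chart domain, which determines it. -/
def riemannianVolume (m : ℕ) (M : Type*) [TopologicalSpace M]
    [ChartedSpace (EuclideanSpace ℝ (Fin m)) M]
    [RiemannianBundle (fun x : M => TangentSpace (𝓡 m) x)] [MeasurableSpace M] : Measure M := ⨆ x : M, chartVolume (m := m) x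

variable [BorelSpace M]

theorem chartVolume_apply (x₀ : M) {A : Set M} (hA : MeasurableSet A) :
    chartVolume (m := m) x₀ A = ∫⁻ y in (extChartAt (𝓡 m) x₀).symm ⁻¹' A ∩ (extChartAt (𝓡 m) x₀).target,
      ENNReal.ofReal √(chartGram x₀ y).det := by
  have h1 : AEMeasurable (extChartAt (𝓡 m) x₀).symm
      ((volume : Measure (EuclideanSpace ℝ (Fin m))).restrict (extChartAt (𝓡 m) x₀).target) :=
    (continuousOn_extChartAt_symm x₀).aemeasurable (isOpen_extChartAt_target x₀).measurableSet
  rw [chartVolume, Measure.map_apply_of_aemeasurable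
    (h1.mono_ac (withDensity_absolutelyContinuous _ _)) hA, withDensity_apply',
    Measure.restrict_restrict' (isOpen_extChartAt_target x₀).measurableSet]

theorem chartVolume_inter_source (x₀ : M) {A : Set M} (hA : MeasurableSet A) :
    chartVolume (m := m) x₀ (A ∩ (extChartAt (𝓡 m) x₀).source) = chartVolume (m := m) x₀ A := by
  rw [chartVolume_apply _ hA,
    chartVolume_apply _ (hA.inter (isOpen_extChartAt_source x₀).measurableSet)]
  congr 2
  ext y
  simp only [preimage_inter, mem_inter_iff, mem_preimage]
  exact ⟨fun h => ⟨h.1.1, h.2⟩, fun h => ⟨⟨h.1, (extChartAt (𝓡 m) x₀).map_target h.2⟩, h.2⟩⟩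

theorem measurableSet_chart_preimage (x₀ : M) {A : Set M} (hA : MeasurableSet A) :
    MeasurableSet ((extChartAt (𝓡 m) x₀).symm ⁻¹' A ∩ (extChartAt (𝓡 m) x₀).target) := by
  have h1 : Measurable ((extChartAt (𝓡 m) x₀).target.domRestrict (extChartAt (𝓡 m) x₀).symm) :=
    (continuousOn_extChartAt_symm x₀).domRestrict.measurable
  have h2 := (isOpen_extChartAt_target (I := 𝓡 m) x₀).measurableSet.subtype_image (h1 hA)
  rwa [show Subtype.val '' ((extChartAt (𝓡 m) x₀).target.domRestrict
    (extChartAt (𝓡 m) x₀).symm ⁻¹' A) = (extChartAt (𝓡 m) x₀).symm ⁻¹' A ∩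
      (extChartAt (𝓡 m) x₀).target from ?_] at h2
  ext y
  constructor
  · rintro ⟨z, hz, rfl⟩
    exact ⟨hz, z.2⟩
  · rintro ⟨h, h'⟩
    exact ⟨⟨y, h'⟩, h, rfl⟩

variable [IsManifold (𝓡 m) ∞ M]

theorem chartVolume_eq {x₀ p : M} {A : Set M} (hA : MeasurableSet A)
    (h0 : A ⊆ (extChartAt (𝓡 m) x₀).source) (hp : A ⊆ (extChartAt (𝓡 m) p).source) :
    chartVolume (m := m) x₀ A = chartVolume (m := m) p A := by
  rw [chartVolume_apply _ hA, chartVolume_apply _ hA]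
  have hmaps : ∀ y ∈ (extChartAt (𝓡 m) p).symm ⁻¹' A ∩ (extChartAt (𝓡 m) p).target,
      ∃ r ∈ A, extChartAt (𝓡 m) p r = y := fun y hy =>
    ⟨_, hy.1, (extChartAt (𝓡 m) p).right_inv hy.2⟩
  have himg : (extChartAt (𝓡 m) x₀).symm ⁻¹' A ∩ (extChartAt (𝓡 m) x₀).target =
      (extChartAt (𝓡 m) x₀ ∘ (extChartAt (𝓡 m) p).symm) ''
        ((extChartAt (𝓡 m) p).symm ⁻¹' A ∩ (extChartAt (𝓡 m) p).target) := by
    ext z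
    constructor
    · rintro ⟨hz1, hz2⟩
      refine ⟨extChartAt (𝓡 m) p ((extChartAt (𝓡 m) x₀).symm z), ⟨?_, ?_⟩, ?_⟩
      · rw [mem_preimage, (extChartAt (𝓡 m) p).left_inv (hp hz1)]; exact hz1
      · exact (extChartAt (𝓡 m) p).map_source (hp hz1)
      · rw [Function.comp, (extChartAt (𝓡 m) p).left_inv (hp hz1),
          (extChartAt (𝓡 m) x₀).right_inv hz2]
    · rintro ⟨y, hy, rfl⟩
      obtain ⟨r, hr, rfl⟩ := hmaps y hy
      rw [Function.comp, (extChartAt (𝓡 m) p).left_inv (hp hr)]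
      refine ⟨?_, (extChartAt (𝓡 m) x₀).map_source (h0 hr)⟩
      rw [mem_preimage, (extChartAt (𝓡 m) x₀).left_inv (h0 hr)]; exact hr
  rw [himg, lintegral_image_eq_lintegral_abs_det_fderiv_mul volume
    (measurableSet_chart_preimage p hA)
    (f' := fun y => fderiv ℝ (extChartAt (𝓡 m) x₀ ∘ (extChartAt (𝓡 m) p).symm) y)]
  · refine setLIntegral_congr_fun (measurableSet_chart_preimage p hA) fun y hy => ?_
    obtain ⟨r, hr, rfl⟩ := hmaps y hy
    rw [chartGram_transition (h0 hr) (hp hr), ENNReal.ofReal_mul (abs_nonneg _), Function.comp,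
      (extChartAt (𝓡 m) p).left_inv (hp hr)]
  · intro y hy
    obtain ⟨r, hr, rfl⟩ := hmaps y hy
    exact ((contDiffAt_transition (h0 hr) (hp hr)).differentiableAt
      (by simp)).hasFDerivAt.hasFDerivWithinAt
  · intro y hy y' hy' h
    obtain ⟨r, hr, rfl⟩ := hmaps y hy
    obtain ⟨r', hr', rfl⟩ := hmaps y' hy'
    simp only [Function.comp, (extChartAt (𝓡 m) p).left_inv (hp hr),
      (extChartAt (𝓡 m) p).left_inv (hp hr')] at h
    rw [(extChartAt (𝓡 m) x₀).injOn (h0 hr) (h0 hr') h]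

variable [SecondCountableTopology M]

/-- In every chart the Riemannian volume is `√det (g_ij) dy`. -/
theorem riemannianVolume_apply {x₀ : M} {A : Set M} (hA : MeasurableSet A)
    (h0 : A ⊆ (extChartAt (𝓡 m) x₀).source) :
    riemannianVolume m M A = chartVolume (m := m) x₀ A := by
  refine le_antisymm ?_ (le_iSup (fun x : M => chartVolume (m := m) x) x₀ A)
  obtain ⟨s, hsc, hs⟩ := TopologicalSpace.countable_cover_nhds
    (fun x : M => extChartAt_source_mem_nhds (I := 𝓡 m) x)
  have hne : s.Nonempty := by
    by_contra h
    rw [not_nonempty_iff_eq_empty] at h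
    simp only [h, mem_empty_iff_false, iUnion_of_empty, iUnion_empty] at hs
    exact (hs ▸ mem_univ x₀ : x₀ ∈ (∅ : Set M))
  obtain ⟨x, rfl⟩ := hsc.exists_eq_range hne
  rw [biUnion_range] at hs
  let D : ℕ → Set M := disjointed fun n => (extChartAt (𝓡 m) (x n)).source
  have hDm : ∀ n, MeasurableSet (D n) :=
    fun n => .disjointed (fun n => (isOpen_extChartAt_source (x n)).measurableSet) n
  have hDs : ∀ n, D n ⊆ (extChartAt (𝓡 m) (x n)).source := fun n => disjointed_subset _ n
  have hDd : Pairwise (Function.onFun Disjoint D) := disjoint_disjointed _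
  have hDu : ⋃ n, D n = univ := by rw [iUnion_disjointed, hs]
  let ν : Measure M := Measure.sum fun n => (chartVolume (m := m) (x n)).restrict (D n)
  have hsplit : ∀ (κ : Measure M) (B : Set M), MeasurableSet B → κ B = ∑' n, κ (B ∩ D n) := by
    intro κ B hB
    rw [← measure_iUnion (fun i j hij => ((hDd hij).mono inter_subset_right inter_subset_right))
      fun n => hB.inter (hDm n), ← inter_iUnion, hDu, inter_univ]
  have hν : ∀ (z : M) (B : Set M), MeasurableSet B → B ⊆ (extChartAt (𝓡 m) z).source →
      ν B = chartVolume (m := m) z B := by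
    intro z B hB hz
    rw [hsplit (chartVolume (m := m) z) B hB, Measure.sum_apply _ hB]
    refine tsum_congr fun n => ?_
    rw [Measure.restrict_apply hB]
    exact chartVolume_eq (hB.inter (hDm n)) (inter_subset_right.trans (hDs n))
      (inter_subset_left.trans hz)
  have hle : riemannianVolume m M ≤ ν := by
    refine iSup_le fun z => Measure.le_iff.2 fun B hB => ?_
    rw [← chartVolume_inter_source z hB, ← hν z _
      (hB.inter (isOpen_extChartAt_source z).measurableSet) inter_subset_right]
    exact measure_mono inter_subset_left
  calc riemannianVolume m M A ≤ ν A := hle A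
    _ = chartVolume (m := m) x₀ A := hν x₀ A hA h0

variable [IsContMDiffRiemannianBundle (𝓡 m) ∞ (EuclideanSpace ℝ (Fin m))
      (fun x : M => TangentSpace (𝓡 m) x)]

instance instIsLocallyFiniteMeasureVolume : IsLocallyFiniteMeasure (riemannianVolume m M) := by
  refine ⟨fun x => ?_⟩
  obtain ⟨r, hr, hsub⟩ := Metric.nhds_basis_closedBall.mem_iff.1
    ((isOpen_extChartAt_target x).mem_nhds (mem_extChartAt_target (I := 𝓡 m) x))
  let N : Set M := (extChartAt (𝓡 m) x).source ∩
    extChartAt (𝓡 m) x ⁻¹' Metric.ball (extChartAt (𝓡 m) x x) r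
  have hN : IsOpen N := (continuousOn_extChartAt x).isOpen_inter_preimage
    (isOpen_extChartAt_source x) Metric.isOpen_ball
  refine ⟨N, hN.mem_nhds ⟨mem_extChartAt_source x, Metric.mem_ball_self hr⟩, ?_⟩
  rw [riemannianVolume_apply hN.measurableSet inter_subset_left,
    chartVolume_apply x hN.measurableSet]
  have hcont : ContinuousOn (fun y => √(chartGram x y).det) (extChartAt (𝓡 m) x).target := by
    refine Real.continuous_sqrt.comp_continuousOn ?_
    refine Continuous.comp_continuousOn (g := Matrix.det) (continuous_id.matrix_det) ?_
    exact continuousOn_chartGram x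
  have hint : IntegrableOn (fun y => √(chartGram x y).det)
      (Metric.closedBall (extChartAt (𝓡 m) x x) r) :=
    (hcont.mono hsub).integrableOn_compact (isCompact_closedBall _ _)
  have hfin : ∫⁻ y in Metric.closedBall (extChartAt (𝓡 m) x x) r,
      ENNReal.ofReal √(chartGram x y).det < ⊤ := by
    have := hint.2
    rw [hasFiniteIntegral_iff_ofReal (Filter.Eventually.of_forall fun y => Real.sqrt_nonneg _)] at this
    exact this
  refine lt_of_le_of_lt (lintegral_mono_set ?_) hfin
  rintro y ⟨hy1, hy2⟩
  have := hy1.2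
  rw [mem_preimage, (extChartAt (𝓡 m) x).right_inv hy2] at this
  exact Metric.ball_subset_closedBall this

end Volume

/-! ## The Sobolev space -/

section Pointwise

variable {m : ℕ} {M : Type*} [TopologicalSpace M] [ChartedSpace (EuclideanSpace ℝ (Fin m)) M]
  [RiemannianBundle (fun x : M => TangentSpace (𝓡 m) x)] [IsManifold (𝓡 m) ∞ M]
  {𝕜 : Type*} [RCLike 𝕜]

theorem gradNorm_nonneg (f : M → 𝕜) (x : M) : 0 ≤ gradNorm m f x := Real.sqrt_nonneg _

theorem hessianNorm_nonneg (f : M → 𝕜) (x : M) : 0 ≤ hessianNorm m f x := Real.sqrt_nonneg _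

theorem gradNorm_eq (f : M → 𝕜) (x : M) : gradNorm m f x =
    ‖(WithLp.toLp 2 fun k => mvfderiv (𝓡 m) f x (tangentBasis m x k) : EuclideanSpace 𝕜 (Fin m))‖ := by
  rw [EuclideanSpace.norm_eq]; rfl

theorem hessianNorm_eq (f : M → 𝕜) (x : M) : hessianNorm m f x =
    ‖(WithLp.toLp 2 fun k => hessian f x (tangentBasis m x k.1) (tangentBasis m x k.2) :
      EuclideanSpace 𝕜 (Fin m × Fin m))‖ := by
  rw [EuclideanSpace.norm_eq, Fintype.sum_prod_type]; rfl

theorem contMDiff_const_smul {f : M → 𝕜} (hf : ContMDiff (𝓡 m) 𝓘(ℝ, 𝕜) ∞ f) (c : 𝕜) :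
    ContMDiff (𝓡 m) 𝓘(ℝ, 𝕜) ∞ (c • f) :=
  (contDiff_const_smul c : ContDiff ℝ ∞ fun x : 𝕜 => c • x).contMDiff.comp hf

theorem contDiffAt_coord_self {f : M → 𝕜} (hf : ContMDiff (𝓡 m) 𝓘(ℝ, 𝕜) ∞ f) (x : M) :
    ContDiffAt ℝ 2 (f ∘ (extChartAt (𝓡 m) x).symm) (extChartAt (𝓡 m) x x) :=
  (contDiffAt_coord hf (mem_extChartAt_source x)).of_le ENat.LEInfty.out

theorem mvfderiv_add_fun {f g : M → 𝕜} (hf : ContMDiff (𝓡 m) 𝓘(ℝ, 𝕜) ∞ f)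
    (hg : ContMDiff (𝓡 m) 𝓘(ℝ, 𝕜) ∞ g) (x : M) (v : TangentSpace (𝓡 m) x) :
    mvfderiv (𝓡 m) (f + g) x v = mvfderiv (𝓡 m) f x v + mvfderiv (𝓡 m) g x v := by
  have h := mem_extChartAt_source (I := 𝓡 m) x
  rw [fderiv_coord (hf.add hg) h, fderiv_coord hf h, fderiv_coord hg h]
  have := fderiv_add ((contDiffAt_coord_self hf x).differentiableAt (by norm_num))
    ((contDiffAt_coord_self hg x).differentiableAt (by norm_num))
  exact congrArg (fun L => L (coordD x x v)) this

theorem mvfderiv_const_smul_fun {f : M → 𝕜} (hf : ContMDiff (𝓡 m) 𝓘(ℝ, 𝕜) ∞ f) (c : 𝕜) (x : M)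
    (v : TangentSpace (𝓡 m) x) : mvfderiv (𝓡 m) (c • f) x v = c • mvfderiv (𝓡 m) f x v := by
  have h := mem_extChartAt_source (I := 𝓡 m) x
  rw [fderiv_coord (contMDiff_const_smul hf c) h, fderiv_coord hf h]
  have := fderiv_const_smul ((contDiffAt_coord_self hf x).differentiableAt (by norm_num)) c
  exact congrArg (fun L => L (coordD x x v)) this

theorem hessian_add {f g : M → 𝕜} (hf : ContMDiff (𝓡 m) 𝓘(ℝ, 𝕜) ∞ f)
    (hg : ContMDiff (𝓡 m) 𝓘(ℝ, 𝕜) ∞ g) (x : M) (u v : TangentSpace (𝓡 m) x) :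
    hessian (f + g) x u v = hessian f x u v + hessian g x u v :=
  coordHessian_add _ (contDiffAt_coord_self hf x) (contDiffAt_coord_self hg x) _ _ _

theorem hessian_const_smul {f : M → 𝕜} (hf : ContMDiff (𝓡 m) 𝓘(ℝ, 𝕜) ∞ f) (c : 𝕜) (x : M)
    (u v : TangentSpace (𝓡 m) x) : hessian (c • f) x u v = c • hessian f x u v :=
  coordHessian_const_smul _ (contDiffAt_coord_self hf x) _ _ _ _

theorem gradNorm_add_le {f g : M → 𝕜} (hf : ContMDiff (𝓡 m) 𝓘(ℝ, 𝕜) ∞ f)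
    (hg : ContMDiff (𝓡 m) 𝓘(ℝ, 𝕜) ∞ g) (x : M) :
    gradNorm m (f + g) x ≤ gradNorm m f x + gradNorm m g x := by
  simp only [gradNorm_eq]
  refine le_of_eq_of_le (congrArg norm ?_) (norm_add_le _ _)
  ext k
  simp [mvfderiv_add_fun hf hg]

theorem hessianNorm_add_le {f g : M → 𝕜} (hf : ContMDiff (𝓡 m) 𝓘(ℝ, 𝕜) ∞ f)
    (hg : ContMDiff (𝓡 m) 𝓘(ℝ, 𝕜) ∞ g) (x : M) :
    hessianNorm m (f + g) x ≤ hessianNorm m f x + hessianNorm m g x := by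
  simp only [hessianNorm_eq]
  refine le_of_eq_of_le (congrArg norm ?_) (norm_add_le _ _)
  ext k
  simp [hessian_add hf hg]

theorem gradNorm_const_smul {f : M → 𝕜} (hf : ContMDiff (𝓡 m) 𝓘(ℝ, 𝕜) ∞ f) (c : 𝕜) :
    gradNorm m (c • f) = ‖c‖ • gradNorm m f := by
  ext x
  rw [Pi.smul_apply, gradNorm_eq, gradNorm_eq, smul_eq_mul, ← norm_smul]
  congr 1
  ext k
  simp [mvfderiv_const_smul_fun hf]

theorem hessianNorm_const_smul {f : M → 𝕜} (hf : ContMDiff (𝓡 m) 𝓘(ℝ, 𝕜) ∞ f) (c : 𝕜) :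
    hessianNorm m (c • f) = ‖c‖ • hessianNorm m f := by
  ext x
  rw [Pi.smul_apply, hessianNorm_eq, hessianNorm_eq, smul_eq_mul, ← norm_smul]
  congr 1
  ext k
  simp [hessian_const_smul hf]

theorem gradNorm_eq_zero {f : M → 𝕜} {x : M} (hf : f =ᶠ[𝓝 x] 0) : gradNorm m f x = 0 := by
  have h : mfderiv (𝓡 m) 𝓘(ℝ, 𝕜) f x = mfderiv (𝓡 m) 𝓘(ℝ, 𝕜) (fun _ : M => (0 : 𝕜)) x :=
    hf.mfderiv_eq
  rw [mfderiv_const] at h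
  have h' : ∀ v, mvfderiv (𝓡 m) f x v = 0 := fun v => congrArg (fun L => L v) h
  simp [gradNorm, h']

theorem hessianNorm_eq_zero {f : M → 𝕜} {x : M} (hf : f =ᶠ[𝓝 x] 0) : hessianNorm m f x = 0 := by
  have h1 : f ∘ (extChartAt (𝓡 m) x).symm =ᶠ[𝓝 (extChartAt (𝓡 m) x x)] 0 := by
    have := continuousAt_extChartAt_symm (I := 𝓡 m) x
    rw [ContinuousAt, extChartAt_to_inv] at this
    exact this.eventually hf
  have h' : ∀ u v, hessian f x u v = 0 := fun u v => coordHessian_eq_zero _ h1 _ _ _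
  simp [hessianNorm, h']

theorem hasCompactSupport_of_local {f : M → 𝕜} {g : M → ℝ} (hf : HasCompactSupport f)
    (h : ∀ x, f =ᶠ[𝓝 x] 0 → g x = 0) : HasCompactSupport g := by
  refine hf.mono' fun x hx => ?_
  by_contra hx'
  exact hx (h x (notMem_tsupport_iff_eventuallyEq.1 hx'))

end Pointwise

section Sobolev

variable (m : ℕ) (M : Type*) [TopologicalSpace M] [ChartedSpace (EuclideanSpace ℝ (Fin m)) M]
  [RiemannianBundle (fun x : M => TangentSpace (𝓡 m) x)] [IsManifold (𝓡 m) ∞ M]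
  [IsContMDiffRiemannianBundle (𝓡 m) ∞ (EuclideanSpace ℝ (Fin m))
    (fun x : M => TangentSpace (𝓡 m) x)]
  [SecondCountableTopology M] [MeasurableSpace M] [BorelSpace M]
  (𝕜 : Type*) [RCLike 𝕜] (q : ENNReal)

/-- The space of all smooth `Ψ : M → 𝕜` with `Ψ`, `|dΨ|`, `|∇dΨ|` in `L^q`. -/
def smoothSobolev : Submodule 𝕜 (M → 𝕜) where
  carrier := {Ψ | ContMDiff (𝓡 m) 𝓘(ℝ, 𝕜) ∞ Ψ ∧ MemLp Ψ q (riemannianVolume m M) ∧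
    MemLp (gradNorm m Ψ) q (riemannianVolume m M) ∧
    MemLp (hessianNorm m Ψ) q (riemannianVolume m M)}
  zero_mem' := by
    have h1 : gradNorm m (0 : M → 𝕜) = 0 := funext fun x => gradNorm_eq_zero (Eventually.of_forall fun _ => rfl)
    have h2 : hessianNorm m (0 : M → 𝕜) = 0 := funext fun x => hessianNorm_eq_zero (Eventually.of_forall fun _ => rfl)
    exact ⟨contMDiff_const, MemLp.zero, h1 ▸ MemLp.zero, h2 ▸ MemLp.zero⟩
  add_mem' := by
    rintro f g ⟨hf, hf0, hf1, hf2⟩ ⟨hg, hg0, hg1, hg2⟩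
    refine ⟨hf.add hg, hf0.add hg0, (hf1.add hg1).mono
      (continuous_gradNorm (hf.add hg)).aestronglyMeasurable (Eventually.of_forall fun x => ?_),
      (hf2.add hg2).mono
      (continuous_hessianNorm (hf.add hg)).aestronglyMeasurable (Eventually.of_forall fun x => ?_)⟩
    · rw [Real.norm_of_nonneg (gradNorm_nonneg _ _)]
      exact (gradNorm_add_le hf hg x).trans (le_abs_self _)
    · rw [Real.norm_of_nonneg (hessianNorm_nonneg _ _)]
      exact (hessianNorm_add_le hf hg x).trans (le_abs_self _)
  smul_mem' := by
    rintro c f ⟨hf, hf0, hf1, hf2⟩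
    refine ⟨contMDiff_const_smul hf c, hf0.const_smul c, ?_, ?_⟩
    · rw [gradNorm_const_smul hf]; exact hf1.const_smul _
    · rw [hessianNorm_const_smul hf]; exact hf2.const_smul _

/-- The same space, to be equipped with the norm `‖Ψ‖_q + ‖dΨ‖_q + ‖∇dΨ‖_q`. -/
def SmoothSobolev : Type _ := smoothSobolev m M 𝕜 q

namespace SmoothSobolev

instance : AddCommGroup (SmoothSobolev m M 𝕜 q) := inferInstanceAs (AddCommGroup (smoothSobolev m M 𝕜 q))

instance : Module 𝕜 (SmoothSobolev m M 𝕜 q) := inferInstanceAs (Module 𝕜 (smoothSobolev m M 𝕜 q))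

instance : Norm (SmoothSobolev m M 𝕜 q) where
  norm Ψ := (eLpNorm Ψ.1 q (riemannianVolume m M)).toReal
    + (eLpNorm (gradNorm m Ψ.1) q (riemannianVolume m M)).toReal
    + (eLpNorm (hessianNorm m Ψ.1) q (riemannianVolume m M)).toReal

theorem core [Fact (1 ≤ q)] : SeminormedSpace.Core 𝕜 (SmoothSobolev m M 𝕜 q) where
  norm_nonneg Ψ := add_nonneg (add_nonneg ENNReal.toReal_nonneg ENNReal.toReal_nonneg)
    ENNReal.toReal_nonneg
  norm_smul := by
    rintro c ⟨f, hf, hf0, hf1, hf2⟩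
    change (eLpNorm (c • f) q (riemannianVolume m M)).toReal
      + (eLpNorm (gradNorm m (c • f)) q (riemannianVolume m M)).toReal
      + (eLpNorm (hessianNorm m (c • f)) q (riemannianVolume m M)).toReal = ‖c‖ *
      ((eLpNorm f q (riemannianVolume m M)).toReal
      + (eLpNorm (gradNorm m f) q (riemannianVolume m M)).toReal
      + (eLpNorm (hessianNorm m f) q (riemannianVolume m M)).toReal)
    rw [gradNorm_const_smul hf, hessianNorm_const_smul hf, eLpNorm_const_smul, eLpNorm_const_smul,
      eLpNorm_const_smul]
    simp only [ENNReal.toReal_mul, toReal_enorm, norm_norm]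
    ring
  norm_triangle := by
    rintro ⟨f, hf, hf0, hf1, hf2⟩ ⟨g, hg, hg0, hg1, hg2⟩
    have hq : 1 ≤ q := Fact.out
    have key : ∀ {a b c : ENNReal}, a ≤ b + c → b ≠ ⊤ → c ≠ ⊤ → a.toReal ≤ b.toReal + c.toReal := by
      intro a b c h hb hc
      rw [← ENNReal.toReal_add hb hc]
      exact ENNReal.toReal_mono (ENNReal.add_ne_top.2 ⟨hb, hc⟩) h
    have h0 := key (eLpNorm_add_le hf0.1 hg0.1 hq) hf0.2.ne hg0.2.ne
    have h1 := key ((eLpNorm_mono_real (f := gradNorm m (f + g)) (g := gradNorm m f + gradNorm m g)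
      fun x => by
      rw [Real.norm_of_nonneg (gradNorm_nonneg _ _)]
      exact gradNorm_add_le hf hg x).trans (eLpNorm_add_le hf1.1 hg1.1 hq)) hf1.2.ne hg1.2.ne
    have h2 := key ((eLpNorm_mono_real (f := hessianNorm m (f + g)) (g := hessianNorm m f + hessianNorm m g)
      fun x => by
      rw [Real.norm_of_nonneg (hessianNorm_nonneg _ _)]
      exact hessianNorm_add_le hf hg x).trans (eLpNorm_add_le hf2.1 hg2.1 hq)) hf2.2.ne hg2.2.ne
    change (eLpNorm (f + g) q (riemannianVolume m M)).toReal
      + (eLpNorm (gradNorm m (f + g)) q (riemannianVolume m M)).toReal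
      + (eLpNorm (hessianNorm m (f + g)) q (riemannianVolume m M)).toReal ≤
      ((eLpNorm f q (riemannianVolume m M)).toReal
      + (eLpNorm (gradNorm m f) q (riemannianVolume m M)).toReal
      + (eLpNorm (hessianNorm m f) q (riemannianVolume m M)).toReal) +
      ((eLpNorm g q (riemannianVolume m M)).toReal
      + (eLpNorm (gradNorm m g) q (riemannianVolume m M)).toReal
      + (eLpNorm (hessianNorm m g) q (riemannianVolume m M)).toReal)
    linarith

instance [Fact (1 ≤ q)] : SeminormedAddCommGroup (SmoothSobolev m M 𝕜 q) :=
  SeminormedAddCommGroup.ofCore (core m M 𝕜 q)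

instance [Fact (1 ≤ q)] : NormedSpace 𝕜 (SmoothSobolev m M 𝕜 q) where
  norm_smul_le c Ψ := ((core m M 𝕜 q).norm_smul c Ψ).le

end SmoothSobolev

/-- The Sobolev space `H^{2,q}(M)`: the Banach space completion of the space of smooth functions `Ψ` with
finite `‖Ψ‖_{2,q} = ‖Ψ‖_q + ‖dΨ‖_q + ‖∇dΨ‖_q` in this norm. -/
abbrev SobolevSpace [Fact (1 ≤ q)] : Type _ := UniformSpace.Completion (SmoothSobolev m M 𝕜 q)

end Sobolev

/-! ## Test functions, Laplacian cut-offs, the Calderón-Zygmund inequality -/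

section Statement

variable (m : ℕ) (M : Type*) [TopologicalSpace M] [ChartedSpace (EuclideanSpace ℝ (Fin m)) M]
  [RiemannianBundle (fun x : M => TangentSpace (𝓡 m) x)]

/-- `χ` is a sequence of Laplacian cut-off functions. -/
structure IsLaplacianCutoff (χ : ℕ → M → ℝ) : Prop where
  smooth : ∀ n, ContMDiff (𝓡 m) 𝓘(ℝ, ℝ) ∞ (χ n)
  compactSupport : ∀ n, HasCompactSupport (χ n)
  nonneg : ∀ n x, 0 ≤ χ n x
  le_one : ∀ n x, χ n x ≤ 1
  /-- Every compact set lies in the level set `χ n = 1` for all large `n`. -/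
  eventually_eq_one : ∀ K : Set M, IsCompact K → ∃ n₀, ∀ n, n₀ ≤ n → ∀ x ∈ K, χ n x = 1
  /-- `sup |dχ_n| → 0`. -/
  grad_tendsto : Tendsto (fun n => ⨆ x, ENNReal.ofReal (gradNorm m (χ n) x)) atTop (𝓝 0)
  /-- `sup |Δχ_n| → 0`. -/
  laplacian_tendsto :
    Tendsto (fun n => ⨆ x, ENNReal.ofReal |laplacian m (χ n) x|) atTop (𝓝 0)

/-- `M` admits a sequence of Laplacian cut-off functions. -/
def AdmitsLaplacianCutoffs : Prop := ∃ χ : ℕ → M → ℝ, IsLaplacianCutoff m M χ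

variable [MeasurableSpace M] (𝕜 : Type*) [RCLike 𝕜] (q : ENNReal)

/-- The `L^q` Calderón-Zygmund inequality `‖∇dΨ‖_q ≤ C ‖ΔΨ‖_q + D ‖Ψ‖_q`, with constants that do not
depend on the smooth compactly supported function `Ψ`. -/
def CalderonZygmund : Prop :=
  ∃ C D : ℝ, 0 < C ∧ 0 ≤ D ∧ ∀ Ψ : M → 𝕜, ContMDiff (𝓡 m) 𝓘(ℝ, 𝕜) ∞ Ψ → HasCompactSupport Ψ →
    eLpNorm (hessianNorm m Ψ) q (riemannianVolume m M) ≤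
      ENNReal.ofReal C * eLpNorm (laplacian m Ψ) q (riemannianVolume m M) +
        ENNReal.ofReal D * eLpNorm Ψ q (riemannianVolume m M)

variable [IsManifold (𝓡 m) ∞ M]
  [IsContMDiffRiemannianBundle (𝓡 m) ∞ (EuclideanSpace ℝ (Fin m))
    (fun x : M => TangentSpace (𝓡 m) x)]
  [SecondCountableTopology M] [BorelSpace M]

variable {M 𝕜}

/-- A smooth compactly supported function as an element of the smooth Sobolev class. -/
def SmoothSobolev.ofCompactSupport [T2Space M] (Ψ : M → 𝕜) (hΨ : ContMDiff (𝓡 m) 𝓘(ℝ, 𝕜) ∞ Ψ)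
    (hc : HasCompactSupport Ψ) : SmoothSobolev m M 𝕜 q :=
  ⟨Ψ, hΨ, hΨ.continuous.memLp_of_hasCompactSupport hc,
    (continuous_gradNorm hΨ).memLp_of_hasCompactSupport
      (hasCompactSupport_of_local hc fun _ => gradNorm_eq_zero),
    (continuous_hessianNorm hΨ).memLp_of_hasCompactSupport
      (hasCompactSupport_of_local hc fun _ => hessianNorm_eq_zero)⟩

variable (M 𝕜)

/-- The image of `C_c^∞(M)` in `H^{2,q}(M)`. -/
def testFunctions [T2Space M] [Fact (1 ≤ q)] : Set (SobolevSpace m M 𝕜 q) :=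
  {u | ∃ (Ψ : M → 𝕜) (hΨ : ContMDiff (𝓡 m) 𝓘(ℝ, 𝕜) ∞ Ψ) (hc : HasCompactSupport Ψ),
    u = ((SmoothSobolev.ofCompactSupport m q Ψ hΨ hc : SmoothSobolev m M 𝕜 q) :
      SobolevSpace m M 𝕜 q)}

end Statement

end RiemSobolev

end

open Bundle

/-! Test functions are dense because `χ n • Ψ → Ψ` in the `H^{2,q}` norm, for Laplacian cut-offs `χ n` and
every smooth `Ψ` with `Ψ`, `|dΨ|`, `|∇dΨ|` in `L^q`. Put `w n = χ n • Ψ - Ψ`.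

By the Leibniz rule, `w n`, `|dw n|` and `|Δw n|` are bounded by `1 - χ n` times a fixed `L^q` function,
plus fixed `L^q` functions multiplied by `sup |dχ n|` or `sup |Δχ n|`; here `|ΔΨ| ≤ √m |∇dΨ|` is used. Dominated
convergence and the assumptions on `χ n` make all of these tend to zero in `L^q`.

The Hessian of `w n` contains the term `Ψ ∇dχ n`, which is not controlled. Instead, the
Calderón-Zygmund inequality is applied to the compactly supported functions
`w n - w k = (χ n - χ k) • Ψ`. It bounds `‖∇d(w n - w k)‖_q` by `B n + B k`, where `B n → 0`. As
`k → ∞`, every point has a neighbourhood on which `w k` eventually vanishes, hence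
`|∇d(w n - w k)| → |∇d(w n)|` pointwise and Fatou's lemma gives `‖∇d(w n)‖_q ≤ B n`
(`IsLaplacianCutoff.tendsto_eLpNorm_hessianNorm`). -/

namespace RiemSobolev

/-! ### Leibniz rules in a normed space -/

section Calculus

variable {E : Type*} [NormedAddCommGroup E] [NormedSpace ℝ E]
  {F : Type*} [NormedAddCommGroup F] [NormedSpace ℝ F]

theorem fderiv_smul_apply {a : E → ℝ} {f : E → F} {y : E} (ha : DifferentiableAt ℝ a y)
    (hf : DifferentiableAt ℝ f y) (v : E) :
    fderiv ℝ (a • f) y v = a y • fderiv ℝ f y v + fderiv ℝ a y v • f y := by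
  rw [fderiv_smul ha hf]
  simp

theorem fderiv_fderiv_smul_apply {a : E → ℝ} {f : E → F} {y : E} (ha : ContDiffAt ℝ 2 a y)
    (hf : ContDiffAt ℝ 2 f y) (u v : E) :
    fderiv ℝ (fderiv ℝ (a • f)) y u v =
      a y • fderiv ℝ (fderiv ℝ f) y u v + fderiv ℝ a y u • fderiv ℝ f y v
        + fderiv ℝ a y v • fderiv ℝ f y u + fderiv ℝ (fderiv ℝ a) y u v • f y := by
  have hda := ha.differentiableAt (by norm_num)
  have hdf := hf.differentiableAt (by norm_num)
  have hda' := differentiableAt_fderiv ha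
  have hdf' := differentiableAt_fderiv hf
  have h2 : DifferentiableAt ℝ (fderiv ℝ (a • f)) y := differentiableAt_fderiv (ha.smul hf)
  have h1 : (fun z => fderiv ℝ (a • f) z v) =ᶠ[𝓝 y]
      (fun z => a z • fderiv ℝ f z v + fderiv ℝ a z v • f z) := by
    filter_upwards [eventually_differentiableAt ha, eventually_differentiableAt hf] with z h h'
    exact fderiv_smul_apply h h' v
  have hL : HasFDerivAt (fun z => fderiv ℝ (a • f) z v) ((fderiv ℝ (fderiv ℝ (a • f)) y).flip v) y := by
    simpa using h2.hasFDerivAt.clm_apply (hasFDerivAt_const v y)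
  have hav : HasFDerivAt (fun z => fderiv ℝ a z v) ((fderiv ℝ (fderiv ℝ a) y).flip v) y := by
    simpa using hda'.hasFDerivAt.clm_apply (hasFDerivAt_const v y)
  have hfv : HasFDerivAt (fun z => fderiv ℝ f z v) ((fderiv ℝ (fderiv ℝ f) y).flip v) y := by
    simpa using hdf'.hasFDerivAt.clm_apply (hasFDerivAt_const v y)
  have hR := (hda.hasFDerivAt.smul hfv).add (hav.smul hdf.hasFDerivAt)
  have := congrArg (fun L => L u) (hL.unique (hR.congr_of_eventuallyEq h1))
  simp at this
  rw [this]
  abel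

theorem coordHessian_smul {m : ℕ} (G : E → E →L[ℝ] E →L[ℝ] ℝ) {a : E → ℝ} {f : E → F} {y : E}
    (ha : ContDiffAt ℝ 2 a y) (hf : ContDiffAt ℝ 2 f y) (e : Fin m → E) (u v : E) :
    coordHessian G (a • f) y e u v =
      a y • coordHessian G f y e u v + fderiv ℝ a y u • fderiv ℝ f y v
        + fderiv ℝ a y v • fderiv ℝ f y u + coordHessian G a y e u v • f y := by
  simp only [coordHessian, fderiv_fderiv_smul_apply ha hf, fderiv_smul_apply
    (ha.differentiableAt (by norm_num)) (hf.differentiableAt (by norm_num)), smul_add, smul_sub,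
    sub_smul, Finset.smul_sum, Finset.sum_smul, Finset.sum_add_distrib, smul_smul, smul_eq_mul,
    mul_comm (a y)]
  abel

end Calculus

/-! ### Leibniz rules and pointwise bounds on the manifold -/

section Pointwise

variable {m : ℕ} {M : Type*} [TopologicalSpace M] [ChartedSpace (EuclideanSpace ℝ (Fin m)) M]
  [RiemannianBundle (fun x : M => TangentSpace (𝓡 m) x)]
  {𝕜 : Type*} [RCLike 𝕜]

theorem hessianNorm_congr {f g : M → 𝕜} {x : M} (h : f =ᶠ[𝓝 x] g) :
    hessianNorm m f x = hessianNorm m g x := by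
  have h1 : f ∘ (extChartAt (𝓡 m) x).symm =ᶠ[𝓝 (extChartAt (𝓡 m) x x)]
      g ∘ (extChartAt (𝓡 m) x).symm := by
    have := continuousAt_extChartAt_symm (I := 𝓡 m) x
    rw [ContinuousAt, extChartAt_to_inv] at this
    exact this.eventually h
  have h2 : ∀ u v : TangentSpace (𝓡 m) x, hessian f x u v = hessian g x u v := fun u v => by
    simp only [hessian, coordHessian, h1.fderiv_eq, (h1.fderiv (𝕜 := ℝ)).fderiv_eq]
  simp only [hessianNorm, h2]

/-- The Laplacian is the trace of the Hessian, hence at most `√m` times its Hilbert-Schmidt norm. -/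
theorem norm_laplacian_le (f : M → 𝕜) (x : M) : ‖laplacian m f x‖ ≤ √m * hessianNorm m f x := by
  refine (norm_sum_le _ _).trans ?_
  have h1 := Real.sum_mul_le_sqrt_mul_sqrt Finset.univ (fun _ : Fin m => (1 : ℝ))
    fun k => ‖hessian f x (tangentBasis m x k) (tangentBasis m x k)‖
  simp only [one_mul, one_pow, Finset.sum_const, Finset.card_univ, Fintype.card_fin, nsmul_eq_mul,
    mul_one] at h1
  refine h1.trans (mul_le_mul_of_nonneg_left (Real.sqrt_le_sqrt ?_) (Real.sqrt_nonneg _))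
  exact Finset.sum_le_sum fun k _ => Finset.single_le_sum
    (f := fun j => ‖hessian f x (tangentBasis m x k) (tangentBasis m x j)‖ ^ 2)
    (fun j _ => by positivity) (Finset.mem_univ k)

variable [IsManifold (𝓡 m) ∞ M]

theorem mvfderiv_smul_fun {a : M → ℝ} {f : M → 𝕜} (ha : ContMDiff (𝓡 m) 𝓘(ℝ, ℝ) ∞ a)
    (hf : ContMDiff (𝓡 m) 𝓘(ℝ, 𝕜) ∞ f) (x : M) (v : TangentSpace (𝓡 m) x) :
    mvfderiv (𝓡 m) (a • f) x v = a x • mvfderiv (𝓡 m) f x v + mvfderiv (𝓡 m) a x v • f x := by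
  have h := mem_extChartAt_source (I := 𝓡 m) x
  rw [fderiv_coord (ha.smul hf) h, fderiv_coord hf h, fderiv_coord ha h]
  have := fderiv_smul_apply ((contDiffAt_coord_self ha x).differentiableAt (by norm_num))
    ((contDiffAt_coord_self hf x).differentiableAt (by norm_num)) (coordD x x v)
  simp only [Function.comp_apply, extChartAt_to_inv] at this
  exact this

theorem hessian_smul_fun {a : M → ℝ} {f : M → 𝕜} (ha : ContMDiff (𝓡 m) 𝓘(ℝ, ℝ) ∞ a)
    (hf : ContMDiff (𝓡 m) 𝓘(ℝ, 𝕜) ∞ f) (x : M) (u v : TangentSpace (𝓡 m) x) :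
    hessian (a • f) x u v = a x • hessian f x u v
      + mvfderiv (𝓡 m) a x u • mvfderiv (𝓡 m) f x v
      + mvfderiv (𝓡 m) a x v • mvfderiv (𝓡 m) f x u + hessian a x u v • f x := by
  have h := mem_extChartAt_source (I := 𝓡 m) x
  have := coordHessian_smul (chartMetric x) (contDiffAt_coord_self ha x)
    (contDiffAt_coord_self hf x) (fun k => tangentBasis m x k) u v
  rw [fderiv_coord ha h, fderiv_coord hf h, fderiv_coord ha h, fderiv_coord hf h, coordD_self,
    coordD_self]
  simp only [Function.comp_apply, extChartAt_to_inv] at this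
  exact this

theorem laplacian_smul_fun {a : M → ℝ} {f : M → 𝕜} (ha : ContMDiff (𝓡 m) 𝓘(ℝ, ℝ) ∞ a)
    (hf : ContMDiff (𝓡 m) 𝓘(ℝ, 𝕜) ∞ f) (x : M) :
    laplacian m (a • f) x = a x • laplacian m f x
      + (2 : ℝ) • ∑ k, mvfderiv (𝓡 m) a x (tangentBasis m x k) •
          mvfderiv (𝓡 m) f x (tangentBasis m x k)
      + laplacian m a x • f x := by
  simp only [laplacian, hessian_smul_fun ha hf, Finset.sum_add_distrib, Finset.smul_sum,
    Finset.sum_smul, two_smul]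
  abel

theorem laplacian_add {f g : M → 𝕜} (hf : ContMDiff (𝓡 m) 𝓘(ℝ, 𝕜) ∞ f)
    (hg : ContMDiff (𝓡 m) 𝓘(ℝ, 𝕜) ∞ g) (x : M) :
    laplacian m (f + g) x = laplacian m f x + laplacian m g x := by
  simp only [laplacian, hessian_add hf hg, Finset.sum_add_distrib]

theorem laplacian_const_smul {f : M → 𝕜} (hf : ContMDiff (𝓡 m) 𝓘(ℝ, 𝕜) ∞ f) (c : 𝕜) (x : M) :
    laplacian m (c • f) x = c • laplacian m f x := by
  simp only [laplacian, hessian_const_smul hf, Finset.smul_sum]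

theorem laplacian_sub {f g : M → 𝕜} (hf : ContMDiff (𝓡 m) 𝓘(ℝ, 𝕜) ∞ f)
    (hg : ContMDiff (𝓡 m) 𝓘(ℝ, 𝕜) ∞ g) (x : M) :
    laplacian m (f - g) x = laplacian m f x - laplacian m g x := by
  have h : f - g = f + (-1 : 𝕜) • g := by rw [neg_one_smul, sub_eq_add_neg]
  rw [h, laplacian_add hf (contMDiff_const_smul hg _), laplacian_const_smul hg, neg_one_smul,
    sub_eq_add_neg]

theorem mvfderiv_sub_fun {f g : M → 𝕜} (hf : ContMDiff (𝓡 m) 𝓘(ℝ, 𝕜) ∞ f)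
    (hg : ContMDiff (𝓡 m) 𝓘(ℝ, 𝕜) ∞ g) (x : M) (v : TangentSpace (𝓡 m) x) :
    mvfderiv (𝓡 m) (f - g) x v = mvfderiv (𝓡 m) f x v - mvfderiv (𝓡 m) g x v := by
  have h : f - g = f + (-1 : 𝕜) • g := by rw [neg_one_smul, sub_eq_add_neg]
  rw [h, mvfderiv_add_fun hf (contMDiff_const_smul hg _), mvfderiv_const_smul_fun hg, neg_one_smul,
    sub_eq_add_neg]

theorem gradNorm_smul_sub_le {a : M → ℝ} {f : M → 𝕜} (ha : ContMDiff (𝓡 m) 𝓘(ℝ, ℝ) ∞ a)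
    (hf : ContMDiff (𝓡 m) 𝓘(ℝ, 𝕜) ∞ f) (x : M) :
    gradNorm m (a • f - f) x ≤ |1 - a x| * gradNorm m f x + gradNorm m a x * ‖f x‖ := by
  have h1 : gradNorm m (a • f - f) x =
      ‖(a x - 1) • (WithLp.toLp 2 fun k => mvfderiv (𝓡 m) f x (tangentBasis m x k) :
          EuclideanSpace 𝕜 (Fin m))
        + (WithLp.toLp 2 fun k => mvfderiv (𝓡 m) a x (tangentBasis m x k) • f x :
          EuclideanSpace 𝕜 (Fin m))‖ := by
    rw [gradNorm_eq]
    congr 1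
    ext k
    simp [mvfderiv_sub_fun (ha.smul hf) hf, mvfderiv_smul_fun ha hf, sub_smul]
    ring
  have h2 : ‖(WithLp.toLp 2 fun k => mvfderiv (𝓡 m) a x (tangentBasis m x k) • f x :
      EuclideanSpace 𝕜 (Fin m))‖ = gradNorm m a x * ‖f x‖ := by
    rw [EuclideanSpace.norm_eq, gradNorm, ← Real.sqrt_sq (norm_nonneg (f x)),
      ← Real.sqrt_mul (Finset.sum_nonneg fun _ _ => by positivity), Finset.sum_mul]
    simp [norm_smul, mul_pow]
  rw [h1, gradNorm_eq f, abs_sub_comm, ← h2, ← Real.norm_eq_abs, ← norm_smul]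
  exact norm_add_le _ _

theorem norm_laplacian_smul_sub_le {a : M → ℝ} {f : M → 𝕜} (ha : ContMDiff (𝓡 m) 𝓘(ℝ, ℝ) ∞ a)
    (hf : ContMDiff (𝓡 m) 𝓘(ℝ, 𝕜) ∞ f) (x : M) :
    ‖laplacian m (a • f - f) x‖ ≤ |1 - a x| * (√m * hessianNorm m f x)
      + 2 * (gradNorm m a x * gradNorm m f x) + |laplacian m a x| * ‖f x‖ := by
  have h1 : laplacian m (a • f - f) x = (a x - 1) • laplacian m f x
      + (2 : ℝ) • ∑ k, mvfderiv (𝓡 m) a x (tangentBasis m x k) •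
          mvfderiv (𝓡 m) f x (tangentBasis m x k) + laplacian m a x • f x := by
    rw [laplacian_sub (ha.smul hf) hf, laplacian_smul_fun ha hf, sub_smul, one_smul]
    abel
  have h2 : ‖∑ k, mvfderiv (𝓡 m) a x (tangentBasis m x k) •
      mvfderiv (𝓡 m) f x (tangentBasis m x k)‖ ≤ gradNorm m a x * gradNorm m f x := by
    refine (norm_sum_le _ _).trans ?_
    simp only [norm_smul]
    exact Real.sum_mul_le_sqrt_mul_sqrt _ _ _
  rw [h1]
  refine norm_add₃_le.trans ?_
  rw [norm_smul, norm_smul, norm_smul, Real.norm_eq_abs, Real.norm_eq_abs, Real.norm_eq_abs,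
    abs_sub_comm, abs_two]
  gcongr
  exact norm_laplacian_le f x

end Pointwise

/-! ### Cut-offs in `L^q` -/

/-- If `χ n → 1` pointwise with `0 ≤ χ n ≤ 1`, then `(1 - χ n) g → 0` in `L^q`, by dominated
convergence. -/
theorem tendsto_eLpNorm_one_sub_mul {α : Type*} [MeasurableSpace α] {μ : Measure α} {q : ENNReal}
    (hq : q ≠ 0) (hq' : q ≠ ⊤) {χ : ℕ → α → ℝ} (hχ : ∀ n, AEStronglyMeasurable (χ n) μ)
    (h0 : ∀ n x, 0 ≤ χ n x) (h1 : ∀ n x, χ n x ≤ 1) (hlim : ∀ x, ∀ᶠ n in atTop, χ n x = 1)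
    {g : α → ℝ} (hg : MemLp g q μ) :
    Tendsto (fun n => eLpNorm (fun x => |1 - χ n x| * g x) q μ) atTop (𝓝 0) := by
  have hr : 0 < q.toReal := ENNReal.toReal_pos hq hq'
  simp only [eLpNorm_eq_lintegral_rpow_enorm_toReal hq hq']
  have key : Tendsto (fun n => ∫⁻ x, ‖|1 - χ n x| * g x‖ₑ ^ q.toReal ∂μ) atTop
      (𝓝 (∫⁻ _, 0 ∂μ)) := by
    refine tendsto_lintegral_of_dominated_convergence' (fun x => ‖g x‖ₑ ^ q.toReal) (fun n => ?_)
      (fun n => Eventually.of_forall fun x => ?_)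
      (lintegral_rpow_enorm_lt_top_of_eLpNorm_lt_top hq hq' hg.2).ne
      (Eventually.of_forall fun x => ?_)
    · have : AEStronglyMeasurable (fun x => |1 - χ n x| * g x) μ :=
        ((aestronglyMeasurable_const.sub (hχ n)).norm).mul hg.1
      exact this.enorm.pow_const _
    · refine ENNReal.rpow_le_rpow (enorm_le_iff_norm_le.2 ?_) hr.le
      rw [norm_mul, Real.norm_eq_abs, abs_abs]
      refine mul_le_of_le_one_left (norm_nonneg _) ?_
      rw [abs_of_nonneg (by linarith [h1 n x])]
      linarith [h0 n x]
    · refine tendsto_const_nhds.congr' ?_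
      filter_upwards [hlim x] with n hn
      simp [hn, hr]
  have h2 := key.ennrpow_const (1 / q.toReal)
  simpa [hr] using h2

/-- A sequence of functions whose suprema tend to zero is eventually dominated by a null sequence of
real constants. -/
theorem exists_null_bound {α : Type*} {g : ℕ → α → ℝ}
    (h : Tendsto (fun n => ⨆ x, ENNReal.ofReal (g n x)) atTop (𝓝 0)) :
    ∃ c : ℕ → ℝ, Tendsto c atTop (𝓝 0) ∧ ∀ᶠ n in atTop, ∀ x, g n x ≤ c n := by
  refine ⟨fun n => (⨆ x, ENNReal.ofReal (g n x)).toReal, ?_, ?_⟩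
  · exact (ENNReal.tendsto_toReal ENNReal.zero_ne_top).comp h
  · filter_upwards [h.eventually_lt_const ENNReal.zero_lt_top] with n hn x
    exact (ENNReal.ofReal_le_iff_le_toReal hn.ne).1 (le_iSup (fun x => ENNReal.ofReal (g n x)) x)

theorem tendsto_eLpNorm_const_mul {α : Type*} [MeasurableSpace α] {μ : Measure α} {q : ENNReal}
    {c : ℕ → ℝ} (hc : Tendsto c atTop (𝓝 0)) {g : α → ℝ} (hg : MemLp g q μ) :
    Tendsto (fun n => eLpNorm (fun x => c n * g x) q μ) atTop (𝓝 0) := by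
  have h : ∀ n, eLpNorm (fun x => c n * g x) q μ = ‖c n‖ₑ * eLpNorm g q μ := fun n =>
    eLpNorm_const_smul (c n) g q μ
  simp only [h]
  have h1 : Tendsto (fun n => ‖c n‖ₑ) atTop (𝓝 0) := by
    simpa using hc.enorm
  simpa using ENNReal.Tendsto.mul_const h1 (Or.inr hg.2.ne)

/-! ### Convergence of `χ n • f` to `f` -/

section Cutoff

variable {m : ℕ} {M : Type*} [TopologicalSpace M] [ChartedSpace (EuclideanSpace ℝ (Fin m)) M]
  [RiemannianBundle (fun x : M => TangentSpace (𝓡 m) x)]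

/-- Every point has a neighbourhood on which the cut-off functions are eventually `1`. -/
theorem IsLaplacianCutoff.eventually_eventuallyEq_one {χ : ℕ → M → ℝ}
    (hχ : IsLaplacianCutoff m M χ) (x : M) : ∀ᶠ n in atTop, ∀ᶠ y in 𝓝 x, χ n y = 1 := by
  have : LocallyCompactSpace M := ChartedSpace.locallyCompactSpace (EuclideanSpace ℝ (Fin m)) M
  obtain ⟨K, hK, hx⟩ := exists_compact_mem_nhds x
  obtain ⟨n₀, hn₀⟩ := hχ.eventually_eq_one K hK
  filter_upwards [eventually_ge_atTop n₀] with n hn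
  filter_upwards [hx] with y hy using hn₀ n hn y hy

variable [MeasurableSpace M] [BorelSpace M] {𝕜 : Type*} [RCLike 𝕜] {q : ENNReal} {χ : ℕ → M → ℝ}
  {f : M → 𝕜}

theorem IsLaplacianCutoff.tendsto_eLpNorm_one_sub_mul (hχ : IsLaplacianCutoff m M χ) (hq : 1 ≤ q)
    (hq' : q ≠ ⊤) {g : M → ℝ} (hg : MemLp g q (riemannianVolume m M)) :
    Tendsto (fun n => eLpNorm (fun x => |1 - χ n x| * g x) q (riemannianVolume m M)) atTop
      (𝓝 0) :=
  RiemSobolev.tendsto_eLpNorm_one_sub_mul (one_pos.trans_le hq).ne' hq'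
    (fun n => (hχ.smooth n).continuous.aestronglyMeasurable) hχ.nonneg hχ.le_one
    (fun x => (hχ.eventually_eventuallyEq_one x).mono fun _ h => h.self_of_nhds) hg

theorem IsLaplacianCutoff.tendsto_eLpNorm_smul_sub (hχ : IsLaplacianCutoff m M χ) (hq : 1 ≤ q)
    (hq' : q ≠ ⊤) (hf : MemLp f q (riemannianVolume m M)) :
    Tendsto (fun n => eLpNorm (χ n • f - f) q (riemannianVolume m M)) atTop (𝓝 0) := by
  refine (hχ.tendsto_eLpNorm_one_sub_mul hq hq' hf.norm).congr fun n => ?_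
  refine eLpNorm_congr_norm_ae (Eventually.of_forall fun x => ?_)
  have : (χ n • f - f) x = (χ n x - 1) • f x := by simp [sub_smul]
  rw [this, norm_smul, norm_mul, norm_norm, Real.norm_eq_abs, Real.norm_eq_abs, abs_abs,
    abs_sub_comm]

variable [IsManifold (𝓡 m) ∞ M]
  [IsContMDiffRiemannianBundle (𝓡 m) ∞ (EuclideanSpace ℝ (Fin m))
    (fun x : M => TangentSpace (𝓡 m) x)]
  [SecondCountableTopology M]

theorem IsLaplacianCutoff.tendsto_eLpNorm_gradNorm (hχ : IsLaplacianCutoff m M χ) (hq : 1 ≤ q)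
    (hq' : q ≠ ⊤) (hfs : ContMDiff (𝓡 m) 𝓘(ℝ, 𝕜) ∞ f) (hf : MemLp f q (riemannianVolume m M))
    (hf1 : MemLp (gradNorm m f) q (riemannianVolume m M)) :
    Tendsto (fun n => eLpNorm (gradNorm m (χ n • f - f)) q (riemannianVolume m M)) atTop
      (𝓝 0) := by
  obtain ⟨c, hc, hcle⟩ := exists_null_bound hχ.grad_tendsto
  have h1 := hχ.tendsto_eLpNorm_one_sub_mul hq hq' hf1
  have h2 := tendsto_eLpNorm_const_mul hc hf.norm
  have h3 := h1.add h2
  rw [add_zero] at h3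
  refine tendsto_of_tendsto_of_tendsto_of_le_of_le' tendsto_const_nhds h3
    (Eventually.of_forall fun _ => zero_le) ?_
  filter_upwards [hcle] with n hn
  have hχc := (hχ.smooth n).continuous
  have hfc := hfs.continuous
  have hgc := continuous_gradNorm hfs
  refine (eLpNorm_mono_real fun x => ?_).trans
    (eLpNorm_add_le (f := fun x => |1 - χ n x| * gradNorm m f x) (g := fun x => c n * ‖f x‖)
      (by fun_prop : Continuous _).aestronglyMeasurable
      (by fun_prop : Continuous _).aestronglyMeasurable hq)
  rw [Real.norm_of_nonneg (gradNorm_nonneg _ _), Pi.add_apply]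
  refine (gradNorm_smul_sub_le (hχ.smooth n) hfs x).trans ?_
  gcongr
  exact hn x

/-- The Laplacians of the errors `χ n f - f` tend to zero in `L^q`. This is stated through continuous
majorants, which makes the triangle inequality available without a separate discussion of the
measurability of `laplacian`. -/
theorem IsLaplacianCutoff.exists_laplacian_majorant (hχ : IsLaplacianCutoff m M χ) (hq : 1 ≤ q)
    (hq' : q ≠ ⊤) (hfs : ContMDiff (𝓡 m) 𝓘(ℝ, 𝕜) ∞ f) (hf : MemLp f q (riemannianVolume m M))
    (hf1 : MemLp (gradNorm m f) q (riemannianVolume m M))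
    (hf2 : MemLp (hessianNorm m f) q (riemannianVolume m M)) :
    ∃ G : ℕ → M → ℝ, (∀ n, Continuous (G n)) ∧
      (∀ᶠ n in atTop, ∀ x, ‖laplacian m (χ n • f - f) x‖ ≤ G n x) ∧
      Tendsto (fun n => eLpNorm (G n) q (riemannianVolume m M)) atTop (𝓝 0) := by
  obtain ⟨b, hb, hble⟩ := exists_null_bound hχ.grad_tendsto
  obtain ⟨c, hc, hcle⟩ := exists_null_bound hχ.laplacian_tendsto
  have h1 := hχ.tendsto_eLpNorm_one_sub_mul hq hq' (hf2.const_mul √m)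
  have h2 := tendsto_eLpNorm_const_mul hb (hf1.const_mul 2)
  have h3 := tendsto_eLpNorm_const_mul hc hf.norm
  have h4 := (h1.add h2).add h3
  rw [add_zero, add_zero] at h4
  have hfc := hfs.continuous
  have hgc := continuous_gradNorm hfs
  have hhc := continuous_hessianNorm hfs
  have m1 : ∀ n, Continuous (fun x => |1 - χ n x| * (√m * hessianNorm m f x)) := fun n => by
    have hχc := (hχ.smooth n).continuous
    fun_prop
  have m2 : ∀ n, Continuous (fun x => b n * (2 * gradNorm m f x)) := fun n => by fun_prop
  have m3 : ∀ n, Continuous (fun x => c n * ‖f x‖) := fun n => by fun_prop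
  refine ⟨fun n => (fun x => |1 - χ n x| * (√m * hessianNorm m f x))
    + (fun x => b n * (2 * gradNorm m f x)) + (fun x => c n * ‖f x‖),
    fun n => ((m1 n).add (m2 n)).add (m3 n), ?_, ?_⟩
  · filter_upwards [hble, hcle] with n hbn hcn x
    refine (norm_laplacian_smul_sub_le (hχ.smooth n) hfs x).trans ?_
    have e : 2 * (gradNorm m (χ n) x * gradNorm m f x) ≤ b n * (2 * gradNorm m f x) := by
      linarith [mul_le_mul_of_nonneg_right (hbn x) (gradNorm_nonneg (m := m) f x)]
    exact add_le_add (add_le_add le_rfl e) (mul_le_mul_of_nonneg_right (hcn x) (norm_nonneg _))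
  · refine tendsto_of_tendsto_of_tendsto_of_le_of_le tendsto_const_nhds h4
      (fun _ => zero_le) fun n => ?_
    exact (eLpNorm_add_le ((m1 n).add (m2 n)).aestronglyMeasurable
      (m3 n).aestronglyMeasurable hq).trans
      (add_le_add (eLpNorm_add_le (m1 n).aestronglyMeasurable (m2 n).aestronglyMeasurable hq)
        le_rfl)

/-- The Hessians of the errors `w n = χ n • f - f` tend to zero in `L^q`. The Calderón-Zygmund inequality
does not apply to `w n` itself, whose support need not be compact, but to the differences `w n - w k`;
Fatou's lemma for `k → ∞` removes `w k`. -/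
theorem IsLaplacianCutoff.tendsto_eLpNorm_hessianNorm (hχ : IsLaplacianCutoff m M χ) (hq : 1 ≤ q)
    (hq' : q ≠ ⊤) (hCZ : CalderonZygmund m M 𝕜 q) (hfs : ContMDiff (𝓡 m) 𝓘(ℝ, 𝕜) ∞ f)
    (hf : MemLp f q (riemannianVolume m M))
    (hf1 : MemLp (gradNorm m f) q (riemannianVolume m M))
    (hf2 : MemLp (hessianNorm m f) q (riemannianVolume m M)) :
    Tendsto (fun n => eLpNorm (hessianNorm m (χ n • f - f)) q (riemannianVolume m M)) atTop
      (𝓝 0) := by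
  obtain ⟨C, D, -, -, hCD⟩ := hCZ
  obtain ⟨G, hGc, hG, hGlim⟩ := hχ.exists_laplacian_majorant hq hq' hfs hf hf1 hf2
  have hw0 := hχ.tendsto_eLpNorm_smul_sub hq hq' hf
  set μ := riemannianVolume m M
  let w : ℕ → M → 𝕜 := fun n => χ n • f - f
  have hw : ∀ n, ContMDiff (𝓡 m) 𝓘(ℝ, 𝕜) ∞ (w n) := fun n => ((hχ.smooth n).smul hfs).sub hfs
  have hwk : ∀ n k, ContMDiff (𝓡 m) 𝓘(ℝ, 𝕜) ∞ (w n - w k) := fun n k => (hw n).sub (hw k)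
  have hsupp : ∀ n k, HasCompactSupport (w n - w k) := fun n k => by
    have h : w n - w k = χ n • f - χ k • f := sub_sub_sub_cancel_right _ _ _
    rw [h]
    exact ((hχ.compactSupport n).smul_right (f' := f)).sub
      ((hχ.compactSupport k).smul_right (f' := f))
  let B : ℕ → ENNReal := fun n =>
    ENNReal.ofReal C * eLpNorm (G n) q μ + ENNReal.ofReal D * eLpNorm (w n) q μ
  have hB : Tendsto B atTop (𝓝 0) := by
    simpa using (ENNReal.Tendsto.const_mul hGlim (Or.inr ENNReal.ofReal_ne_top)).add
      (ENNReal.Tendsto.const_mul hw0 (Or.inr ENNReal.ofReal_ne_top))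
  have hdiff : ∀ᶠ n in atTop, ∀ᶠ k in atTop,
      eLpNorm (hessianNorm m (w n - w k)) q μ ≤ B n + B k := by
    filter_upwards [hG] with n hn
    filter_upwards [hG] with k hk
    have h1 : eLpNorm (laplacian m (w n - w k)) q μ ≤ eLpNorm (G n) q μ + eLpNorm (G k) q μ := by
      refine (eLpNorm_mono_real fun x => ?_).trans (eLpNorm_add_le
        (hGc n).aestronglyMeasurable (hGc k).aestronglyMeasurable hq)
      rw [laplacian_sub (hw n) (hw k)]
      exact (norm_sub_le _ _).trans (add_le_add (hn x) (hk x))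
    have h2 : eLpNorm (w n - w k) q μ ≤ eLpNorm (w n) q μ + eLpNorm (w k) q μ :=
      eLpNorm_sub_le (hw n).continuous.aestronglyMeasurable
        (hw k).continuous.aestronglyMeasurable hq
    calc eLpNorm (hessianNorm m (w n - w k)) q μ
        ≤ ENNReal.ofReal C * (eLpNorm (G n) q μ + eLpNorm (G k) q μ)
          + ENNReal.ofReal D * (eLpNorm (w n) q μ + eLpNorm (w k) q μ) :=
          (hCD _ (hwk n k) (hsupp n k)).trans (by gcongr)
      _ = B n + B k := by simp only [B]; ring
  have hpt : ∀ n x, Tendsto (fun k => hessianNorm m (w n - w k) x) atTop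
      (𝓝 (hessianNorm m (w n) x)) := fun n x => by
    refine tendsto_const_nhds.congr' ?_
    filter_upwards [hχ.eventually_eventuallyEq_one x] with k hk
    refine hessianNorm_congr ?_
    filter_upwards [hk] with y hy
    simp [w, hy]
  refine tendsto_of_tendsto_of_tendsto_of_le_of_le' tendsto_const_nhds hB
    (Eventually.of_forall fun _ => zero_le) ?_
  filter_upwards [hdiff] with n hn
  have hBn : Tendsto (fun k => B n + B k) atTop (𝓝 (B n)) := by
    simpa using tendsto_const_nhds.add hB
  calc eLpNorm (hessianNorm m (w n)) q μ
      ≤ liminf (fun k => eLpNorm (hessianNorm m (w n - w k)) q μ) atTop :=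
        Lp.eLpNorm_lim_le_liminf_eLpNorm
          (fun k => (continuous_hessianNorm (hwk n k)).aestronglyMeasurable) _
          (Eventually.of_forall fun x => hpt n x)
    _ ≤ liminf (fun k => B n + B k) atTop := liminf_le_liminf hn
    _ = B n := hBn.liminf_eq

end Cutoff

end RiemSobolev

/-! ### Density -/

theorem theorem2p5 {m : ℕ} {M : Type*} [TopologicalSpace M]
    [ChartedSpace (EuclideanSpace ℝ (Fin m)) M] [IsManifold (𝓡 m) ∞ M]
    [T2Space M] [SecondCountableTopology M] [ConnectedSpace M]
    [RiemannianBundle (fun x : M => TangentSpace (𝓡 m) x)]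
    [IsContMDiffRiemannianBundle (𝓡 m) ∞ (EuclideanSpace ℝ (Fin m))
      (fun x : M => TangentSpace (𝓡 m) x)]
    [MeasurableSpace M] [BorelSpace M]
    {𝕜 : Type*} [RCLike 𝕜]
    (q : ENNReal) [Fact (1 ≤ q)] (hq : 1 < q) (hq' : q ≠ ⊤)
    (hcut : RiemSobolev.AdmitsLaplacianCutoffs m M)
    (hCZ : RiemSobolev.CalderonZygmund m M 𝕜 q) :
    Dense (RiemSobolev.testFunctions m M 𝕜 q) := by
  obtain ⟨χ, hχ⟩ := hcut
  refine dense_closure.1 (UniformSpace.Completion.denseRange_coe.mono ?_)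
  rintro _ ⟨⟨f, hfs, hf, hf1, hf2⟩, rfl⟩
  have hsm : ∀ n, ContMDiff (𝓡 m) 𝓘(ℝ, 𝕜) ∞ (χ n • f) := fun n => (hχ.smooth n).smul hfs
  have hsupp : ∀ n, HasCompactSupport (χ n • f) := fun n =>
    (hχ.compactSupport n).smul_right (f' := f)
  let F : RiemSobolev.SmoothSobolev m M 𝕜 q := ⟨f, hfs, hf, hf1, hf2⟩
  let u : ℕ → RiemSobolev.SmoothSobolev m M 𝕜 q := fun n =>
    RiemSobolev.SmoothSobolev.ofCompactSupport m q (χ n • f) (hsm n) (hsupp n)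
  have hu : Tendsto u atTop (𝓝 F) := by
    refine tendsto_iff_norm_sub_tendsto_zero.2 ?_
    have h0 := hχ.tendsto_eLpNorm_smul_sub hq.le hq' hf
    have h1 := hχ.tendsto_eLpNorm_gradNorm hq.le hq' hfs hf hf1
    have h2 := hχ.tendsto_eLpNorm_hessianNorm hq.le hq' hCZ hfs hf hf1 hf2
    have ht := ENNReal.tendsto_toReal ENNReal.zero_ne_top
    have := ((ht.comp h0).add (ht.comp h1)).add (ht.comp h2)
    simp only [ENNReal.toReal_zero, add_zero] at this
    exact this
  exact mem_closure_of_tendsto ((UniformSpace.Completion.continuous_coe _).continuousAt.tendsto.comp hu)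
    (Eventually.of_forall fun n => ⟨χ n • f, hsm n, hsupp n, rfl⟩)
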